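/- **Setting.** Let $f:\mathbb R^n\to\mathbb R$ be differentiable and bounded below, $f^*=\inf f$, with $\|\nabla f(y)-\nabla f(x)\|\le L\|y-x\|$ for all $x,y$, where $L>0$. Let $\sigma>0$, $\tilde D>0$, $x_1\in\mathbb R^n$, and let $G(x,\xi)$ be a Borel function (the stochastic first-order oracle: a call at $x$ returns $G(x,\xi)$ for a random $\xi$). Put $$D_f=\Big[\tfrac{2(f(x_1)-f^*)}{L}\Big]^{1/2},\qquad \mathcal B_N=\frac{LD_f^2}{N}+\Big(\tilde D+\frac{D_f^2}{\tilde D}\Big)\frac{\sigma}{\sqrt N}.$$ **RSG method** (randomized stochastic gradient, iteration limit $N\ge1$). Use the stepsizes $\gamma_k=\min\{1/L,\tilde D/(\sigma\sqrt N)\}$. Draw $R\in\{1,\dots,N\}$ with $P\{R=k\}=(2\gamma_k-L\gamma_k^2)/\sum_{j=1}^N(2\gamma_j-L\gamma_j^2)$, independently of the oracle inputs of the run; for $k=1,\dots,R$ call the oracle and set $x_{k+1}=x_k-\gamma_kG(x_k,\xi_k)$; output $x_R$. **2-RSG method** with parameters $S,N,T\ge1$. Run the RSG method $S$ times independently from $x_1$,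 with outputs $\bar x_1,\dots,\bar x_S$. For each $s$ compute $g(\bar x_s)=\frac1T\sum_{k=1}^TG(\bar x_s,\zeta_{s,k})$ with $T$ oracle calls (the same inputs may be used for different $s$). Output a candidate $\bar x^*\in\{\bar x_1,\dots,\bar x_S\}$ with $\|g(\bar x^*)\|=\min_s\|g(\bar x_s)\|$. **Assumptions on the oracle.** For every oracle call, at the (random) query point $X$ with random input $\xi$, almost surely $$\mathbb E[G(X,\xi)\mid\mathcal H]=\nabla f(X),\qquad \mathbb E\big[\exp\{\|G(X,\xi)-\nabla f(X)\|^2/\sigma^2\}\mid\mathcal H\big]\le e,$$ and $\mathbb E\|G(X,\xi)-\nabla f(X)\|^2\le\sigma^2$. Here $\mathcal H$ is the past of the call: for the $k$-th call of an RSG run, the $\sigma$-algebra generated by the earlier inputs $\xi_1,\dots,\xi_{k-1}$ of that run; for the $k$-th call at $\bar x_s$ in the second phase, the $\sigma$-algebra generated by the whole first phase and $\zeta_{s,1},\dots,\zeta_{s,k-1}$. **Claim.** (a) For all $S,N,T\ge1$ and all $\lambda>0$, $$P\Big\{\|\nabla f(\bar x^*)\|^2\ge4\Big[2L\mathcal B_N+3(1+\lambda)^2\frac{\sigma^2}{T}\Big]\Big\}\le(S+1)\exp(-\lambda^2/3)+2^{-S}.$$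 (b) Let $\varepsilon>0$ and $\Lambda\in(0,1)$, and set $$S=\lceil\log_2(2/\Lambda)\rceil,\qquad N=\Big\lceil\max\Big\{\frac{32L^2D_f^2}{\varepsilon},\Big[32L\Big(\tilde D+\frac{D_f^2}{\tilde D}\Big)\frac{\sigma}{\varepsilon}\Big]^2\Big\}\Big\rceil,$$ $$T=T':=\Big\lceil\frac{24\sigma^2}{\varepsilon}\Big[1+\Big(3\ln\frac{2(S+1)}{\Lambda}\Big)^{1/2}\Big]^2\Big\rceil.$$ Then the 2-RSG method makes at most $S\,[N+T']$ oracle calls, and its output satisfies $P\{\|\nabla f(\bar x^*)\|^2\le\varepsilon\}\ge1-\Lambda$, i.e. it is an $(\varepsilon,\Lambda)$-solution. -/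

import Mathlib

open MeasureTheory ProbabilityTheory

noncomputable section

namespace TwoRSG

variable {E Ξ Ω : Type*}

section Parameters

variable [NormedAddCommGroup E] [InnerProductSpace ℝ E] [CompleteSpace E]

/-- `D_f = [2 (f(x₁) - f^*) / L]^{1/2}`, where `f^* = inf f`. -/
def Df (f : E → ℝ) (L : ℝ) (x₁ : E) : ℝ :=
  Real.sqrt (2 * (f x₁ - ⨅ x, f x) / L)

/-- `B_N = L D_f² / N + (D̃ + D_f² / D̃) σ / √N`. -/
def BN (f : E → ℝ) (L σ Dt : ℝ) (x₁ : E) (N : ℕ) : ℝ :=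
  L * Df f L x₁ ^ 2 / N + (Dt + Df f L x₁ ^ 2 / Dt) * (σ / Real.sqrt N)

/-- The constant stepsize policy `γ_k = min {1 / L, D̃ / (σ √N)}`. -/
def stepsize (L σ Dt : ℝ) (N : ℕ) (_k : ℕ) : ℝ :=
  min (1 / L) (Dt / (σ * Real.sqrt N))

/-- The probability mass function
`P_R(k) = (2 γ_k - L γ_k²) / ∑_{j=1}^N (2 γ_j - L γ_j²)` on `{1, …, N}`. -/
def stopPmf (L : ℝ) (γ : ℕ → ℝ) (N k : ℕ) : ℝ :=
  (2 * γ k - L * γ k ^ 2) / ∑ j ∈ Finset.Icc 1 N, (2 * γ j - L * γ j ^ 2)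

/-- `S(Λ) = ⌈log₂ (2 / Λ)⌉`. -/
def Sparam (Λ : ℝ) : ℕ := ⌈Real.logb 2 (2 / Λ)⌉₊

/-- `N(ε) = ⌈max {32 L² D_f² / ε, [32 L (D̃ + D_f² / D̃) σ / ε]²}⌉`. -/
def Nparam (f : E → ℝ) (L σ Dt : ℝ) (x₁ : E) (ε : ℝ) : ℕ :=
  ⌈max (32 * L ^ 2 * Df f L x₁ ^ 2 / ε)
    ((32 * L * (Dt + Df f L x₁ ^ 2 / Dt) * (σ / ε)) ^ 2)⌉₊

/-- `T'(ε, Λ) = ⌈(24 σ² / ε) [1 + (3 ln (2 (S + 1) / Λ))^{1/2}]²⌉` with `S = S(Λ)`. -/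
def Tparam (σ ε Λ : ℝ) : ℕ :=
  ⌈24 * σ ^ 2 / ε *
    (1 + Real.sqrt (3 * Real.log (2 * ((Sparam Λ : ℝ) + 1) / Λ))) ^ 2⌉₊

end Parameters

section Algorithm

variable [AddCommGroup E] [Module ℝ E]

/-- The stochastic gradient loop `x_{k+1} = x_k - γ_k G(x_k, ξ_k)`. After `m` steps it returns
the pair `(x_{m+1}, number of oracle calls made so far)`. -/
def sgLoop (G : E → Ξ → E) (γ : ℕ → ℝ) (x₁ : E) (ξ : ℕ → Ξ) : ℕ → E × ℕ
  | 0 => (x₁, 0)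
  | m + 1 =>
    let p := sgLoop G γ x₁ ξ m
    (p.1 - γ (m + 1) • G p.1 (ξ (m + 1)), p.2 + 1)

/-- The search point `x_k`, `k ≥ 1`. -/
def searchPoint (G : E → Ξ → E) (γ : ℕ → ℝ) (x₁ : E) (ξ : ℕ → Ξ) (k : ℕ) : E :=
  (sgLoop G γ x₁ ξ (k - 1)).1

/-- One run of the RSG method with stopping index `r`: steps `k = 1, …, r` are executed and
`x_r` is returned, together with the number of oracle calls made. -/
def rsg (G : E → Ξ → E) (γ : ℕ → ℝ) (x₁ : E) (ξ : ℕ → Ξ) (r : ℕ) : E × ℕ :=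
  (searchPoint G γ x₁ ξ r, (sgLoop G γ x₁ ξ r).2)

/-- Accumulates `G(x, ζ_1) + … + G(x, ζ_m)`, together with the number of oracle calls made. -/
def gradSum (G : E → Ξ → E) (x : E) (ζ : ℕ → Ξ) : ℕ → E × ℕ
  | 0 => (0, 0)
  | m + 1 =>
    let p := gradSum G x ζ m
    (p.1 + G x (ζ (m + 1)), p.2 + 1)

/-- The estimator `g(x) = (1 / T) ∑_{k=1}^T G(x, ζ_k)`, with the number of oracle calls made. -/
def gradEst (G : E → Ξ → E) (x : E) (ζ : ℕ → Ξ) (T : ℕ) : E × ℕ :=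
  ((1 / (T : ℝ)) • (gradSum G x ζ T).1, (gradSum G x ζ T).2)

/-- The random inputs of the two-phase method with `S` runs, on a sample space `Ω`, together with
the index of the candidate that it selects. -/
structure Run (Ω Ξ : Type*) (S : ℕ) where
  /-- `R s` is the stopping index of the `s`-th run of the RSG method. -/
  R : Fin S → Ω → ℕ
  /-- `ξ s k` drives the `k`-th oracle call, `k ≥ 1`, of the `s`-th run of the RSG method. -/
  ξ : Fin S → ℕ → Ω → Ξ
  /-- `ζ s k` drives the `k`-th oracle call, `k ≥ 1`, of the post-optimization phase at the `s`-th
  candidate. The same sequence may be used for different `s`. -/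
  ζ : Fin S → ℕ → Ω → Ξ
  /-- The index of the selected candidate. -/
  pick : Ω → Fin S

variable {S : ℕ}

/-- The candidate `x̄_s` (with the number of oracle calls of the `s`-th run). -/
def Run.cand (run : Run Ω Ξ S) (G : E → Ξ → E) (γ : ℕ → ℝ) (x₁ : E) (s : Fin S) (ω : Ω) :
    E × ℕ :=
  rsg G γ x₁ (fun k => run.ξ s k ω) (run.R s ω)

/-- The estimate `g(x̄_s)` (with the number of oracle calls used for it). -/
def Run.est (run : Run Ω Ξ S) (G : E → Ξ → E) (γ : ℕ → ℝ) (x₁ : E) (T : ℕ) (s : Fin S) (ω : Ω) :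
    E × ℕ :=
  gradEst G (run.cand G γ x₁ s ω).1 (fun k => run.ζ s k ω) T

/-- The output `x̄^*` of the two-phase method. -/
def Run.output (run : Run Ω Ξ S) (G : E → Ξ → E) (γ : ℕ → ℝ) (x₁ : E) (ω : Ω) : E :=
  (run.cand G γ x₁ (run.pick ω) ω).1

/-- The total number of oracle calls of the two-phase method. -/
def Run.calls (run : Run Ω Ξ S) (G : E → Ξ → E) (γ : ℕ → ℝ) (x₁ : E) (T : ℕ) (ω : Ω) : ℕ :=
  ∑ s, (run.cand G γ x₁ s ω).2 + ∑ s, (run.est G γ x₁ T s ω).2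

end Algorithm

section Probability

variable [MeasurableSpace Ξ]

/-- The σ-algebra `σ(ξ_j : 1 ≤ j < k)`. -/
abbrev sigmaBefore (ξ : ℕ → Ω → Ξ) (k : ℕ) : MeasurableSpace Ω :=
  ⨆ j ∈ Finset.Ico 1 k, MeasurableSpace.comap (ξ j) inferInstance

/-- The σ-algebra generated by the whole optimization phase. -/
abbrev Run.sigmaOpt {S : ℕ} (run : Run Ω Ξ S) (N : ℕ) : MeasurableSpace Ω :=
  ⨆ s, (MeasurableSpace.comap (run.R s) inferInstance ⊔ sigmaBefore (run.ξ s) (N + 1))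

variable [NormedAddCommGroup E] [InnerProductSpace ℝ E] [CompleteSpace E]
  [MeasurableSpace Ω]

/-- Assumption A1 for one oracle call at the random point `X` with random input `ξ`, the past of
the call being `H`: `E[G(X, ξ) | H] = ∇f(X)` almost surely and `E ‖G(X, ξ) - ∇f(X)‖² ≤ σ²`. -/
def A1 (μ : Measure Ω) (f : E → ℝ) (G : E → Ξ → E) (σ : ℝ) (H : MeasurableSpace Ω)
    (X : Ω → E) (ξ : Ω → Ξ) : Prop :=
  Integrable (fun ω => G (X ω) (ξ ω)) μ ∧
  (μ[fun ω => G (X ω) (ξ ω) | H] =ᵐ[μ] fun ω => gradient f (X ω)) ∧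
  ∫⁻ ω, ENNReal.ofReal (‖G (X ω) (ξ ω) - gradient f (X ω)‖ ^ 2) ∂μ ≤ ENNReal.ofReal (σ ^ 2)

/-- Assumption A2 (light tail) for one oracle call at the random point `X` with random input `ξ`,
the past of the call being `H`: `E[exp (‖G(X, ξ) - ∇f(X)‖² / σ²) | H] ≤ e` almost surely. -/
def A2 (μ : Measure Ω) (f : E → ℝ) (G : E → Ξ → E) (σ : ℝ) (H : MeasurableSpace Ω)
    (X : Ω → E) (ξ : Ω → Ξ) : Prop :=
  Integrable (fun ω => Real.exp (‖G (X ω) (ξ ω) - gradient f (X ω)‖ ^ 2 / σ ^ 2)) μ ∧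
  μ[fun ω => Real.exp (‖G (X ω) (ξ ω) - gradient f (X ω)‖ ^ 2 / σ ^ 2) | H]
    ≤ᵐ[μ] fun _ => Real.exp 1

/-- `run` is an execution of the two-phase method with parameters `(S, N, T)`: every `R s` has
the mass function `P_R` and is independent of the oracle inputs of its run, the `S` runs of the
RSG method are independent, and the selected candidate minimizes `‖g(x̄_s)‖`. -/
structure Run.IsExecution {S : ℕ} (run : Run Ω Ξ S) (μ : Measure Ω)
    (G : E → Ξ → E) (L : ℝ) (γ : ℕ → ℝ) (x₁ : E) (N T : ℕ) : Prop where
  measurable_R : ∀ s, Measurable (run.R s)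
  measurable_ξ : ∀ s k, Measurable (run.ξ s k)
  measurable_ζ : ∀ s k, Measurable (run.ζ s k)
  measurable_pick : Measurable run.pick
  R_mem : ∀ s ω, run.R s ω ∈ Finset.Icc 1 N
  R_law : ∀ s, ∀ k ∈ Finset.Icc 1 N, μ.real {ω | run.R s ω = k} = stopPmf L γ N k
  R_indep : ∀ s, IndepFun (run.R s) (fun ω k => run.ξ s k ω) μ
  runs_indep : iIndepFun (fun s ω => (run.R s ω, fun k => run.ξ s k ω)) μ
  pick_min : ∀ ω s, ‖(run.est G γ x₁ T (run.pick ω) ω).1‖ ≤ ‖(run.est G γ x₁ T s ω).1‖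

/-- Both assumptions hold for every oracle call of the two-phase method. In the `s`-th run of the
RSG method the past of the `k`-th call is generated by the earlier inputs of that run; in the
post-optimization phase the past of the `k`-th call at the candidate `x̄_s` is generated by the
optimization phase and the earlier inputs used at that candidate. -/
structure Run.OracleAssumptions {S : ℕ} (run : Run Ω Ξ S) (μ : Measure Ω) (f : E → ℝ)
    (G : E → Ξ → E) (σ : ℝ) (γ : ℕ → ℝ) (x₁ : E) (N T : ℕ) : Prop where
  opt_A1 : ∀ s, ∀ k ∈ Finset.Icc 1 N, A1 μ f G σ (sigmaBefore (run.ξ s) k)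
    (fun ω => searchPoint G γ x₁ (fun j => run.ξ s j ω) k) (run.ξ s k)
  opt_A2 : ∀ s, ∀ k ∈ Finset.Icc 1 N, A2 μ f G σ (sigmaBefore (run.ξ s) k)
    (fun ω => searchPoint G γ x₁ (fun j => run.ξ s j ω) k) (run.ξ s k)
  post_A1 : ∀ s, ∀ k ∈ Finset.Icc 1 T,
    A1 μ f G σ (run.sigmaOpt N ⊔ sigmaBefore (run.ζ s) k)
      (fun ω => (run.cand G γ x₁ s ω).1) (run.ζ s k)
  post_A2 : ∀ s, ∀ k ∈ Finset.Icc 1 T,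
    A2 μ f G σ (run.sigmaOpt N ⊔ sigmaBefore (run.ζ s) k)
      (fun ω => (run.cand G γ x₁ s ω).1) (run.ζ s k)

end Probability

end TwoRSG

end

/-! The failure event is covered by two kinds of bad events.

No good candidate: telescoping the descent lemma along a run, with noise orthogonal in expectation
to the gradient, gives `E ‖∇f(x_R)‖² ≤ L B_N` (`integral_sq_gradient_stop_le`). By Markov at twice
this level each run fails with probability at most 1/2, and independence of the runs yields
`2^{-S}`.

A bad estimate: given the first phase, the errors of the oracle at a candidate are martingale
differences with light tails. The dimension-free bound `measureReal_norm_sum_ge_le` follows from an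
exponential moment argument with `cosh ‖·‖` in place of `exp`: by `cosh_norm_add_le` an increment
`v` costs a factor `exp ‖v‖ - ‖v‖` plus a term linear in `v`, which has conditional mean zero. Light
tails bound the conditional mean of the factor at scale `t` by `exp (4/5 t²)`. The constants are
tuned so that the factor 2 from `exp x ≤ 2 cosh x` is absorbed and the tail is exactly `exp
(-λ²/3)`.

Outside these events the minimizer of the estimated norm is nearly as good as the best candidate
(`sq_norm_lt_of_argmin`). Weighted squares turn the deviation constant 9/4 into `16/3 · 9/4 = 12 = 4
· 3`, the constant of the claim. Part (b) splits `ε` and `Λ` into halves, one for each kind of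
error. -/

namespace TwoRSG

/-! ### Scalar and Hilbert space inequalities for the exponential moment method -/

/-- The function `s ↦ cosh √s` is convex on `[0, ∞)`. -/
theorem convexOn_cosh_sqrt : ConvexOn ℝ (Set.Ici 0) fun s : ℝ => Real.cosh (√s) := by
  -- The power series in `s` has nonnegative coefficients, so convexity can be checked term by term.
  have key (s : ℝ) (hs : 0 ≤ s) :
      HasSum (fun n : ℕ => s ^ n / ((2 * n).factorial : ℝ)) (Real.cosh (√s)) := by
    have h := Real.hasSum_cosh (√s)
    simpa only [pow_mul, Real.sq_sqrt hs] using h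
  refine ⟨convex_Ici 0, fun x hx y hy a b ha hb hab => ?_⟩
  have hx' : (0 : ℝ) ≤ x := hx
  have hy' : (0 : ℝ) ≤ y := hy
  simp only [smul_eq_mul]
  refine hasSum_le (fun n => ?_) (key (a * x + b * y) (by positivity))
    (((key x hx').mul_left a).add ((key y hy').mul_left b))
  have h := (convexOn_pow (𝕜 := ℝ) n).2 hx hy ha hb hab
  simp only [smul_eq_mul] at h
  calc (a * x + b * y) ^ n / ((2 * n).factorial : ℝ)
      ≤ (a * x ^ n + b * y ^ n) / ((2 * n).factorial : ℝ) := by gcongr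
    _ = _ := by ring

/-- A second order bound for `cosh ‖·‖` in an inner product space. -/
theorem cosh_norm_add_le {E : Type*} [NormedAddCommGroup E] [InnerProductSpace ℝ E] (x v : E) :
    Real.cosh ‖x + v‖ ≤ Real.cosh ‖x‖ * (Real.exp ‖v‖ - ‖v‖)
      + inner ℝ ((Real.sinh ‖x‖ / ‖x‖) • x) v := by
  have hexp : Real.exp ‖v‖ = Real.cosh ‖v‖ + Real.sinh ‖v‖ := (Real.cosh_add_sinh _).symm
  have hsinh : ‖v‖ ≤ Real.sinh ‖v‖ := Real.self_le_sinh_iff.2 (norm_nonneg v)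
  rcases eq_or_ne x 0 with rfl | hx
  · simp only [zero_add, norm_zero, Real.cosh_zero, smul_zero, inner_zero_left]
    linarith
  rcases eq_or_ne v 0 with rfl | hv
  · simp
  have ha : 0 < ‖x‖ := norm_pos_iff.2 hx
  have hd : 0 < ‖v‖ := norm_pos_iff.2 hv
  rw [real_inner_smul_left]
  have hin := abs_le.1 (abs_real_inner_le_norm x v)
  have hsq : ‖x + v‖ ^ 2 = ‖x‖ ^ 2 + 2 * inner ℝ x v + ‖v‖ ^ 2 := norm_add_sq_real x v
  have hcosh : Real.cosh ‖x + v‖ = Real.cosh (√(‖x + v‖ ^ 2)) := by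
    rw [Real.sqrt_sq (norm_nonneg _)]
  generalize inner ℝ x v = p at *
  generalize ‖x‖ = a at *
  generalize ‖v‖ = d at *
  -- `c` is the component of `v` along `x`. The number `‖x + v‖²` is then the convex combination of
  -- `(a + d)²` and `(a - d)²` with weights `(d ± c) / (2 d)`, which suits the convexity of `cosh
  -- √s`.
  obtain ⟨c, rfl⟩ : ∃ c, p = a * c := ⟨p / a, by field_simp⟩
  have hc1 : -d ≤ c := by nlinarith
  have hc2 : c ≤ d := by nlinarith
  have hconv := convexOn_cosh_sqrt.2
    (Set.mem_Ici.2 (sq_nonneg (a + d))) (Set.mem_Ici.2 (sq_nonneg (a - d)))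
    (show 0 ≤ (d + c) / (2 * d) from div_nonneg (by linarith) (by linarith))
    (show 0 ≤ (d - c) / (2 * d) from div_nonneg (by linarith) (by linarith))
    (by field_simp; ring)
  have harg : (d + c) / (2 * d) * (a + d) ^ 2 + (d - c) / (2 * d) * (a - d) ^ 2
      = a ^ 2 + 2 * (a * c) + d ^ 2 := by field_simp; ring
  simp only [smul_eq_mul] at hconv
  rw [harg, Real.sqrt_sq_eq_abs, Real.sqrt_sq_eq_abs, Real.cosh_abs, Real.cosh_abs,
    Real.cosh_add, Real.cosh_sub] at hconv
  rw [hcosh, hsq, hexp]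
  have hr : Real.sinh a / a * (a * c) = Real.sinh a * c := by field_simp
  rw [hr]
  have hs : (d + c) / (2 * d) * (Real.cosh a * Real.cosh d + Real.sinh a * Real.sinh d)
      + (d - c) / (2 * d) * (Real.cosh a * Real.cosh d - Real.sinh a * Real.sinh d)
      = Real.cosh a * Real.cosh d + Real.sinh a * (c / d * Real.sinh d) := by field_simp; ring
  rw [hs] at hconv
  refine hconv.trans ?_
  have hsa : 0 ≤ Real.sinh a := Real.sinh_nonneg_iff.2 ha.le
  have hsc : Real.sinh a ≤ Real.cosh a := (Real.sinh_lt_cosh a).le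
  have hcd : c / d ≤ 1 := (div_le_one hd).2 hc2
  -- Replacing `sinh d` by `d` isolates the linear term `sinh a * c`; the excess `sinh d - d` is
  -- nonnegative and is charged to `cosh a`.
  have e1 : c / d * Real.sinh d - c ≤ Real.sinh d - d := by
    have : c = c / d * d := by field_simp
    calc c / d * Real.sinh d - c = c / d * (Real.sinh d - d) := by
            rw [mul_sub, ← this]
      _ ≤ 1 * (Real.sinh d - d) := by
            apply mul_le_mul_of_nonneg_right hcd; linarith
      _ = _ := one_mul _
  have e2 := mul_le_mul_of_nonneg_left e1 hsa
  have e3 := mul_le_mul_of_nonneg_right hsc (sub_nonneg.2 hsinh)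
  linarith

/-- Beyond 25/16 the exponent on the right dominates. Below it a Taylor comparison decides, carried
out at `y = x / 2` so that the argument stays in `[0, 1]`, where the remainder estimate for `exp`
applies. -/
theorem exp_le_add_exp_sq {x : ℝ} (hx : 0 ≤ x) :
    Real.exp x ≤ x + Real.exp (16 / 25 * x ^ 2) := by
  rcases le_total (25 / 16) x with h | h
  · have : Real.exp x ≤ Real.exp (16 / 25 * x ^ 2) := Real.exp_le_exp.2 (by nlinarith)
    linarith
  obtain ⟨y, rfl⟩ : ∃ y, x = 2 * y := ⟨x / 2, by ring⟩
  have hy : 0 ≤ y := by linarith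
  have hy' : y ≤ 4 / 5 := by linarith
  have h1 := Real.exp_bound' hy (by linarith) (n := 4) (by norm_num)
  have h2 := Real.quadratic_le_exp_of_nonneg (x := 16 / 25 * (2 * y) ^ 2) (by positivity)
  simp only [Finset.sum_range_succ, Finset.sum_range_zero, Nat.factorial] at h1
  norm_num at h1
  have h3 : Real.exp (2 * y) = Real.exp y ^ 2 := by rw [← Real.exp_nat_mul]; norm_num
  have h4 : Real.exp y ^ 2 ≤ (1 + y + y ^ 2 / 2 + y ^ 3 / 6 + y ^ 4 * 5 / 96) ^ 2 := by
    gcongr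
  have p5 : y ^ 5 ≤ 4 / 5 * y ^ 4 := by
    have := mul_le_mul_of_nonneg_left hy' (pow_nonneg hy 4); nlinarith
  have p6 : y ^ 6 ≤ y ^ 4 := by
    exact pow_le_pow_of_le_one hy (by linarith) (by norm_num)
  have p7 : y ^ 7 ≤ y ^ 4 := pow_le_pow_of_le_one hy (by linarith) (by norm_num)
  have p8 : y ^ 8 ≤ y ^ 4 := pow_le_pow_of_le_one hy (by linarith) (by norm_num)
  -- This square trades the cubic Taylor term for quadratic and quartic ones.
  have p4 : 0 ≤ y ^ 2 * (y - 1 / 3) ^ 2 := by positivity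
  have p2 : 0 ≤ y ^ 2 := by positivity
  have p44 : 0 ≤ y ^ 4 := by positivity
  rw [h3]
  nlinarith

/-- Weighted arithmetic-geometric mean bound: `exp (θ u) ≤ e^θ ((1 - θ) + θ e⁻¹ exp u)`. -/
theorem exp_mul_le_of_mem_unit {θ u : ℝ} (h0 : 0 ≤ θ) (h1 : θ ≤ 1) :
    Real.exp (θ * u) ≤
      Real.exp θ * (1 - θ) + Real.exp θ * (θ * Real.exp (-1)) * Real.exp u := by
  have h := convexOn_exp.2 (Set.mem_univ 0) (Set.mem_univ (u - 1)) (sub_nonneg.2 h1) h0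
    (by ring)
  simp only [smul_eq_mul, mul_zero, zero_add, Real.exp_zero, mul_one] at h
  have e1 : Real.exp (θ * u) = Real.exp θ * Real.exp (θ * (u - 1)) := by
    rw [← Real.exp_add]; ring_nf
  have e2 : Real.exp (u - 1) = Real.exp (-1) * Real.exp u := by
    rw [← Real.exp_add]; ring_nf
  rw [e1]
  calc Real.exp θ * Real.exp (θ * (u - 1))
      ≤ Real.exp θ * (1 - θ + θ * Real.exp (u - 1)) := by gcongr
    _ = _ := by rw [e2]; ring

/-- The only information on the tail is the conditional mean of `exp (d²)`, so the majorant must be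
affine in that quantity; `α + β e` is then what conditioning produces. -/
theorem exists_affine_bound_exp {t : ℝ} (ht : 0 < t) :
    ∃ α β : ℝ, 0 ≤ β ∧ α + β * Real.exp 1 ≤ Real.exp (4 / 5 * t ^ 2) ∧
      ∀ d : ℝ, 0 ≤ d → Real.exp (t * d) - t * d ≤ α + β * Real.exp (d ^ 2) := by
  have he : Real.exp (-1) * Real.exp 1 = 1 := by rw [← Real.exp_add]; simp
  rcases le_total (16 / 25 * t ^ 2) 1 with h | h
  · refine ⟨Real.exp (16 / 25 * t ^ 2) * (1 - 16 / 25 * t ^ 2),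
      Real.exp (16 / 25 * t ^ 2) * (16 / 25 * t ^ 2 * Real.exp (-1)), by positivity, ?_,
      fun d hd => ?_⟩
    · calc _ = Real.exp (16 / 25 * t ^ 2) * (1 - 16 / 25 * t ^ 2
            + 16 / 25 * t ^ 2 * (Real.exp (-1) * Real.exp 1)) := by ring
        _ = Real.exp (16 / 25 * t ^ 2) := by rw [he]; ring
        _ ≤ _ := Real.exp_le_exp.2 (by nlinarith [sq_nonneg t])
    · have h1 := exp_le_add_exp_sq (mul_nonneg ht.le hd)
      have h2 := exp_mul_le_of_mem_unit (u := d ^ 2) (by positivity) h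
      have h3 : 16 / 25 * (t * d) ^ 2 = 16 / 25 * t ^ 2 * d ^ 2 := by ring
      rw [h3] at h1
      linarith
  -- For large `t` the bound uses `t d ≤ 2/5 t² + 5/8 d²`. The case condition `t² ≥ 25/16` is
  -- exactly `5/8 ≤ 2/5 t²`, so the total exponent is at most `4/5 t²`.
  · refine ⟨Real.exp (2 / 5 * t ^ 2) * (Real.exp (5 / 8) * (1 - 5 / 8)),
      Real.exp (2 / 5 * t ^ 2) * (Real.exp (5 / 8) * (5 / 8 * Real.exp (-1))), by positivity, ?_,
      fun d hd => ?_⟩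
    · calc _ = Real.exp (2 / 5 * t ^ 2) * Real.exp (5 / 8) * (1 - 5 / 8
            + 5 / 8 * (Real.exp (-1) * Real.exp 1)) := by ring
        _ = Real.exp (2 / 5 * t ^ 2 + 5 / 8) := by rw [he, Real.exp_add]; ring
        _ ≤ _ := Real.exp_le_exp.2 (by linarith)
    · have h2 := exp_mul_le_of_mem_unit (θ := 5 / 8) (u := d ^ 2) (by norm_num) (by norm_num)
      have h3 : Real.exp (t * d) ≤ Real.exp (2 / 5 * t ^ 2) * Real.exp (5 / 8 * d ^ 2) := by
        rw [← Real.exp_add]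
        exact Real.exp_le_exp.2 (by nlinarith [sq_nonneg (4 * t - 5 * d)])
      have h4 := mul_le_mul_of_nonneg_left h2 (Real.exp_pos (2 / 5 * t ^ 2)).le
      have h5 : 0 ≤ t * d := by positivity
      linarith

/-! ### Concentration of vector valued martingales with light tails -/

section Concentration

variable {E Ω : Type*} [NormedAddCommGroup E] [InnerProductSpace ℝ E] [CompleteSpace E]
  {m m0 : MeasurableSpace Ω} {μ : Measure Ω}

theorem integral_inner_eq_zero_of_condExp_eq_zero [IsFiniteMeasure μ] (hm : m ≤ m0)
    {X v : Ω → E} (hX : StronglyMeasurable[m] X) (hv : Integrable v μ)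
    (hXv : Integrable (fun ω => inner ℝ (X ω) (v ω)) μ) (h0 : μ[v | m] =ᵐ[μ] 0) :
    ∫ ω, inner ℝ (X ω) (v ω) ∂μ = 0 := by
  obtain ⟨B, hB⟩ : ∃ B : E →L[ℝ] E →L[ℝ] ℝ, ∀ x y, B x y = inner ℝ x y :=
    ⟨innerSL ℝ, fun _ _ => rfl⟩
  have h := condExp_bilin_of_stronglyMeasurable_left (μ := μ) B hX (by simpa only [hB] using hXv) hv
  simp only [hB] at h
  rw [← integral_condExp hm]
  refine (integral_congr_ae ?_).trans (integral_zero _ _)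
  filter_upwards [h, h0] with ω h1 h2
  rw [h1, h2]
  simp

theorem integral_mul_le_of_condExp_le [IsFiniteMeasure μ] (hm : m ≤ m0)
    {Z Y : Ω → ℝ} {C : ℝ} (hZ : StronglyMeasurable[m] Z) (hZ0 : ∀ ω, 0 ≤ Z ω)
    (hZi : Integrable Z μ) (hY : Integrable Y μ) (hZY : Integrable (fun ω => Z ω * Y ω) μ)
    (hC : μ[Y | m] ≤ᵐ[μ] fun _ => C) :
    ∫ ω, Z ω * Y ω ∂μ ≤ C * ∫ ω, Z ω ∂μ := by
  have h := condExp_mul_of_stronglyMeasurable_left (μ := μ) hZ hZY hY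
  rw [← integral_const_mul, ← integral_condExp hm]
  refine integral_mono_ae integrable_condExp (hZi.const_mul C) ?_
  filter_upwards [h, hC] with ω h1 h2
  have h1' : (μ[fun ω => Z ω * Y ω | m]) ω = Z ω * (μ[Y | m]) ω := h1
  rw [h1', mul_comm C]
  exact mul_le_mul_of_nonneg_left h2 (hZ0 ω)

/-- Light tails bound the conditional expectation of `exp (t ‖v‖) - t ‖v‖`. -/
theorem condExp_exp_sub_le [IsFiniteMeasure μ] (hm : m ≤ m0) {d : Ω → ℝ} (hd : ∀ ω, 0 ≤ d ω)
    {t : ℝ} (ht : 0 < t) (hY : Integrable (fun ω => Real.exp (t * d ω) - t * d ω) μ)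
    (hexp : Integrable (fun ω => Real.exp (d ω ^ 2)) μ)
    (hle : μ[fun ω => Real.exp (d ω ^ 2) | m] ≤ᵐ[μ] fun _ => Real.exp 1) :
    μ[fun ω => Real.exp (t * d ω) - t * d ω | m] ≤ᵐ[μ] fun _ => Real.exp (4 / 5 * t ^ 2) := by
  obtain ⟨α, β, hβ, hαβ, hb⟩ := exists_affine_bound_exp ht
  have h1 := condExp_mono (μ := μ) (m := m) hY ((integrable_const α).add (hexp.const_mul β))
    (Filter.Eventually.of_forall fun ω => hb _ (hd ω))
  have h2 := condExp_add (μ := μ) (integrable_const α) (hexp.const_mul β) m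
  have h3 := condExp_smul (μ := μ) β (fun ω => Real.exp (d ω ^ 2)) m
  have h4 := condExp_const (μ := μ) hm α
  filter_upwards [h1, h2, h3, hle] with ω h1 h2 h3 hle
  have h3' : (μ[fun ω => β * Real.exp (d ω ^ 2) | m]) ω
      = β * (μ[fun ω => Real.exp (d ω ^ 2) | m]) ω := h3
  rw [Pi.add_apply, h4, h3'] at h2
  have := mul_le_mul_of_nonneg_left hle hβ
  linarith [h1.trans_eq h2]

theorem integrable_exp_mul_of_integrable_exp_sq [IsFiniteMeasure μ] {d : Ω → ℝ}
    (hd : AEStronglyMeasurable d μ) (hexp : Integrable (fun ω => Real.exp (d ω ^ 2)) μ) (s : ℝ) :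
    Integrable (fun ω => Real.exp (s * d ω)) μ := by
  refine (hexp.const_mul (Real.exp (s ^ 2))).mono'
    (Real.continuous_exp.comp_aestronglyMeasurable (hd.const_mul s))
    (Filter.Eventually.of_forall fun ω => ?_)
  rw [Real.norm_of_nonneg (Real.exp_pos _).le, ← Real.exp_add]
  exact Real.exp_le_exp.2 (by nlinarith [sq_nonneg (s - d ω)])

theorem memLp_two_exp {d : Ω → ℝ} (hd : AEStronglyMeasurable d μ)
    (h : ∀ s : ℝ, Integrable (fun ω => Real.exp (s * d ω)) μ) (s : ℝ) :
    MemLp (fun ω => Real.exp (s * d ω)) 2 μ := by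
  refine (memLp_two_iff_integrable_sq
    (Real.continuous_exp.comp_aestronglyMeasurable (hd.const_mul s))).2 ?_
  refine (h (2 * s)).congr (Filter.Eventually.of_forall fun ω => ?_)
  simp only [← Real.exp_nat_mul]
  push_cast
  ring_nf

/-- Cauchy–Schwarz separates the last summand at the price of doubling `s`, hence the quantifier
over all `s` inside the induction. -/
theorem integrable_exp_norm_sum {E : Type*} [NormedAddCommGroup E] [IsFiniteMeasure μ]
    {v : ℕ → Ω → E} {T : ℕ}
    (hv : ∀ k < T, AEStronglyMeasurable (v k) μ)
    (hexp : ∀ k < T, Integrable (fun ω => Real.exp (‖v k ω‖ ^ 2)) μ) :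
    ∀ k ≤ T, ∀ s : ℝ, 0 ≤ s →
      Integrable (fun ω => Real.exp (s * ‖∑ j ∈ Finset.range k, v j ω‖)) μ := by
  intro k
  induction k with
  | zero => intro _ s _; simp
  | succ k ih =>
    intro hk s hs
    have hk' : k < T := hk
    have hsum (k : ℕ) (hk : k ≤ T) :
        AEStronglyMeasurable (fun ω => ‖∑ j ∈ Finset.range k, v j ω‖) μ :=
      (Finset.aestronglyMeasurable_fun_sum _ fun j hj =>
        hv j ((Finset.mem_range.1 hj).trans_le hk)).norm
    have hmul (s : ℝ) {d : Ω → ℝ} (hd : AEStronglyMeasurable d μ) :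
        AEStronglyMeasurable (fun ω => Real.exp (s * d ω)) μ :=
      Real.continuous_exp.comp_aestronglyMeasurable (hd.const_mul s)
    have h1 : MemLp (fun ω => Real.exp (s * ‖∑ j ∈ Finset.range k, v j ω‖)) 2 μ := by
      refine (memLp_two_iff_integrable_sq (hmul s (hsum k hk'.le))).2 ?_
      refine (ih hk'.le (2 * s) (by positivity)).congr (Filter.Eventually.of_forall fun ω => ?_)
      simp only [← Real.exp_nat_mul]
      push_cast
      ring_nf
    have h2 : MemLp (fun ω => Real.exp (s * ‖v k ω‖)) 2 μ :=
      memLp_two_exp (hv k hk').norm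
        (integrable_exp_mul_of_integrable_exp_sq (hv k hk').norm (hexp k hk')) s
    refine (h1.integrable_mul h2).mono' (hmul s (hsum (k + 1) hk))
      (Filter.Eventually.of_forall fun ω => ?_)
    rw [Real.norm_of_nonneg (Real.exp_pos _).le, Pi.mul_apply, ← Real.exp_add]
    refine Real.exp_le_exp.2 ?_
    rw [Finset.sum_range_succ, ← mul_add]
    exact mul_le_mul_of_nonneg_left (norm_add_le _ _) hs

variable [MeasurableSpace E] [BorelSpace E] [SecondCountableTopology E]

/-- One step multiplies the expectation of `cosh (t ‖·‖)` by at most `exp (4/5 t²)`, because the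
part linear in the new increment integrates to zero. `F k` is the past of the increment `v k`. -/
theorem integral_cosh_norm_sum_le [IsProbabilityMeasure μ] {v : ℕ → Ω → E} {T : ℕ}
    {F : ℕ → MeasurableSpace Ω} (hF : ∀ k < T, F k ≤ m0)
    (hadapt : ∀ k < T, StronglyMeasurable[F k] fun ω => ∑ j ∈ Finset.range k, v j ω)
    (hv : ∀ k < T, Integrable (v k) μ) (h0 : ∀ k < T, μ[v k | F k] =ᵐ[μ] 0)
    (hexp : ∀ k < T, Integrable (fun ω => Real.exp (‖v k ω‖ ^ 2)) μ)
    (hle : ∀ k < T, μ[fun ω => Real.exp (‖v k ω‖ ^ 2) | F k] ≤ᵐ[μ] fun _ => Real.exp 1)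
    {t : ℝ} (ht : 0 < t) :
    ∀ k ≤ T, Integrable (fun ω => Real.cosh (t * ‖∑ j ∈ Finset.range k, v j ω‖)) μ ∧
      ∫ ω, Real.cosh (t * ‖∑ j ∈ Finset.range k, v j ω‖) ∂μ
        ≤ Real.exp (4 / 5 * t ^ 2) ^ k := by
  have hcosh_le (a : ℝ) (ha : 0 ≤ a) : Real.cosh a ≤ Real.exp a := by
    rw [← Real.cosh_add_sinh]
    linarith [Real.sinh_nonneg_iff.2 ha]
  have hint (k : ℕ) (hk : k ≤ T) :
      Integrable (fun ω => Real.cosh (t * ‖∑ j ∈ Finset.range k, v j ω‖)) μ := by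
    refine (integrable_exp_norm_sum (fun k hk => (hv k hk).aestronglyMeasurable) hexp k hk t
      ht.le).mono' (Real.continuous_cosh.comp_aestronglyMeasurable
        (((Finset.aestronglyMeasurable_fun_sum _ fun j hj =>
          (hv j ((Finset.mem_range.1 hj).trans_le hk)).aestronglyMeasurable).norm).const_mul t))
        (Filter.Eventually.of_forall fun ω => ?_)
    rw [Real.norm_of_nonneg (Real.cosh_pos _).le]
    exact hcosh_le _ (by positivity)
  intro k
  induction k with
  | zero => intro _; simp
  | succ k ih =>
    intro hk
    refine ⟨hint (k + 1) hk, ?_⟩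
    have hk' : k < T := hk
    have hS := hadapt k hk'
    have hSm : StronglyMeasurable fun ω => ∑ j ∈ Finset.range k, v j ω := hS.mono (hF k hk')
    have hI := integrable_exp_norm_sum (fun k hk => (hv k hk).aestronglyMeasurable) hexp k hk'.le
    have ih' := ih hk'.le
    have hvk := (hv k hk').aestronglyMeasurable
    have hE := integrable_exp_mul_of_integrable_exp_sq hvk.norm (hexp k hk')
    generalize hu : (fun ω => ∑ j ∈ Finset.range k, v j ω) = u at hS hSm
    have hu' (ω : Ω) : ∑ j ∈ Finset.range k, v j ω = u ω := congrFun hu ω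
    simp only [Finset.sum_range_succ, hu'] at hI ih' ⊢
    set Z : Ω → ℝ := fun ω => Real.cosh (t * ‖u ω‖) with hZdef
    set Y : Ω → ℝ := fun ω => Real.exp (t * ‖v k ω‖) - t * ‖v k ω‖ with hYdef
    -- The predictable coefficient of the linear term. At `u ω = 0` the quotient is `0 / 0 = 0`, and
    -- the vector vanishes in any case.
    set X : Ω → E := fun ω => (t * (Real.sinh ‖t • u ω‖ / ‖t • u ω‖)) • (t • u ω) with hXdef
    have hexpu : MemLp (fun ω => Real.exp (t * ‖u ω‖)) 2 μ := by
      refine (memLp_two_iff_integrable_sq (Real.continuous_exp.comp_aestronglyMeasurable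
        (hSm.aestronglyMeasurable.norm.const_mul t))).2 ?_
      refine (hI (2 * t) (by positivity)).congr (Filter.Eventually.of_forall fun ω => ?_)
      simp only [← Real.exp_nat_mul]
      push_cast
      ring_nf
    have hexpv (s : ℝ) : MemLp (fun ω => Real.exp (s * ‖v k ω‖)) 2 μ := memLp_two_exp hvk.norm hE s
    have hZm : StronglyMeasurable[F k] Z :=
      Real.continuous_cosh.comp_stronglyMeasurable (hS.norm.const_mul t)
    have hXm : StronglyMeasurable[F k] X := by
      have : Measurable fun x : E => (t * (Real.sinh ‖t • x‖ / ‖t • x‖)) • (t • x) := by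
        fun_prop
      exact (this.comp hS.measurable).stronglyMeasurable
    have hYm : AEStronglyMeasurable Y μ :=
      (Real.continuous_exp.comp_aestronglyMeasurable (hvk.norm.const_mul t)).sub
        (hvk.norm.const_mul t)
    have hY0 (ω : Ω) : 0 ≤ Y ω := by
      have := Real.add_one_le_exp (t * ‖v k ω‖)
      simp only [hYdef]; linarith
    have hYle (ω : Ω) : Y ω ≤ Real.exp (t * ‖v k ω‖) := by
      have : 0 ≤ t * ‖v k ω‖ := by positivity
      simp only [hYdef]; linarith
    have hYi : Integrable Y μ := (hE t).mono' hYm (Filter.Eventually.of_forall fun ω => by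
      rw [Real.norm_of_nonneg (hY0 ω)]; exact hYle ω)
    have hZY : Integrable (fun ω => Z ω * Y ω) μ := by
      refine (hexpu.integrable_mul (hexpv t)).mono'
        ((hZm.mono (hF k hk')).aestronglyMeasurable.mul hYm)
        (Filter.Eventually.of_forall fun ω => ?_)
      rw [Real.norm_of_nonneg (mul_nonneg (Real.cosh_pos _).le (hY0 ω))]
      exact mul_le_mul (hcosh_le _ (by positivity)) (hYle ω) (hY0 ω) (Real.exp_pos _).le
    have hXn (ω : Ω) : ‖X ω‖ ≤ t * Real.exp (t * ‖u ω‖) := by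
      have e1 : ‖t • u ω‖ = t * ‖u ω‖ := by rw [norm_smul, Real.norm_of_nonneg ht.le]
      have e2 : 0 ≤ Real.sinh (t * ‖u ω‖) := Real.sinh_nonneg_iff.2 (by positivity)
      have e3 : Real.sinh (t * ‖u ω‖) ≤ Real.exp (t * ‖u ω‖) :=
        (Real.sinh_lt_cosh _).le.trans (hcosh_le _ (by positivity))
      simp only [hXdef]
      rw [norm_smul, Real.norm_of_nonneg (by rw [e1]; positivity), mul_assoc, e1]
      refine mul_le_mul_of_nonneg_left (le_trans ?_ e3) ht.le
      rcases (mul_nonneg ht.le (norm_nonneg (u ω))).eq_or_lt' with h | h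
      · simp [h]
      · exact (div_mul_cancel₀ _ h.ne').le
    have hXv : Integrable (fun ω => inner ℝ (X ω) (v k ω)) μ := by
      refine ((hexpu.integrable_mul (hexpv 1)).const_mul t).mono'
        ((hXm.mono (hF k hk')).aestronglyMeasurable.inner hvk)
        (Filter.Eventually.of_forall fun ω => ?_)
      refine (norm_inner_le_norm _ _).trans ?_
      have : ‖v k ω‖ ≤ Real.exp (1 * ‖v k ω‖) := by
        have := Real.add_one_le_exp ‖v k ω‖
        rw [one_mul]; linarith
      calc ‖X ω‖ * ‖v k ω‖ ≤ (t * Real.exp (t * ‖u ω‖)) * Real.exp (1 * ‖v k ω‖) :=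
            mul_le_mul (hXn ω) this (norm_nonneg _) (by positivity)
        _ = _ := by simp only [Pi.mul_apply]; ring
    have hpt (ω : Ω) : Real.cosh (t * ‖u ω + v k ω‖) ≤ Z ω * Y ω + inner ℝ (X ω) (v k ω) := by
      have h := cosh_norm_add_le (t • u ω) (t • v k ω)
      have e (x : E) : ‖t • x‖ = t * ‖x‖ := by rw [norm_smul, Real.norm_of_nonneg ht.le]
      rw [← smul_add, e (u ω + v k ω), e (v k ω), real_inner_smul_right] at h
      simp only [hXdef, hZdef, hYdef]
      rw [mul_smul, real_inner_smul_left _ _ t, ← e (u ω)]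
      exact h
    have hk1 := hint (k + 1) hk
    simp only [Finset.sum_range_succ, hu'] at hk1
    calc ∫ ω, Real.cosh (t * ‖u ω + v k ω‖) ∂μ
        ≤ ∫ ω, (Z ω * Y ω + inner ℝ (X ω) (v k ω)) ∂μ :=
          integral_mono hk1 (hZY.add hXv) hpt
      _ = ∫ ω, Z ω * Y ω ∂μ := by
          rw [integral_add hZY hXv,
            integral_inner_eq_zero_of_condExp_eq_zero (hF k hk') hXm (hv k hk') hXv (h0 k hk'),
            add_zero]
      _ ≤ Real.exp (4 / 5 * t ^ 2) * ∫ ω, Z ω ∂μ :=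
          integral_mul_le_of_condExp_le (hF k hk') hZm (fun ω => (Real.cosh_pos _).le) ih'.1 hYi
            hZY (condExp_exp_sub_le (hF k hk') (fun ω => norm_nonneg _) ht hYi (hexp k hk')
              (hle k hk'))
      _ ≤ Real.exp (4 / 5 * t ^ 2) * Real.exp (4 / 5 * t ^ 2) ^ k :=
          mul_le_mul_of_nonneg_left ih'.2 (Real.exp_pos _).le
      _ = _ := (pow_succ' _ _).symm

/-- A large deviation bound for vector valued martingale differences with light tails. -/
theorem measureReal_norm_sum_ge_le [IsProbabilityMeasure μ] {v : ℕ → Ω → E} {T : ℕ} (hT : 1 ≤ T)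
    {F : ℕ → MeasurableSpace Ω} (hF : ∀ k < T, F k ≤ m0)
    (hadapt : ∀ k < T, StronglyMeasurable[F k] fun ω => ∑ j ∈ Finset.range k, v j ω)
    (hv : ∀ k < T, Integrable (v k) μ) (h0 : ∀ k < T, μ[v k | F k] =ᵐ[μ] 0)
    {σ : ℝ} (hσ : 0 < σ)
    (hexp : ∀ k < T, Integrable (fun ω => Real.exp (‖v k ω‖ ^ 2 / σ ^ 2)) μ)
    (hle : ∀ k < T, μ[fun ω => Real.exp (‖v k ω‖ ^ 2 / σ ^ 2) | F k] ≤ᵐ[μ] fun _ => Real.exp 1)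
    {lam : ℝ} (hlam : 0 < lam) :
    μ.real {ω | 3 / 2 * (1 + lam) * σ * √T ≤ ‖∑ j ∈ Finset.range T, v j ω‖}
      ≤ Real.exp (-lam ^ 2 / 3) := by
  have hT0 : (0 : ℝ) < T := by exact_mod_cast hT
  have hsT : 0 < √(T : ℝ) := Real.sqrt_pos.2 hT0
  have hnorm (x : E) : ‖σ⁻¹ • x‖ = ‖x‖ / σ := by
    rw [norm_smul, norm_inv, Real.norm_of_nonneg hσ.le]; ring
  -- The minimizer of `4/5 T t² - t r`, where `r = 3/2 (1 + lam) √T` is the threshold in units of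
  -- `σ`.
  set t : ℝ := 15 / 16 * (1 + lam) / √T with ht
  have ht0 : 0 < t := by positivity
  obtain ⟨hi, hb⟩ := integral_cosh_norm_sum_le (v := fun k ω => σ⁻¹ • v k ω) hF
    (fun k hk => by
      simp only [← Finset.smul_sum]
      exact (hadapt k hk).const_smul σ⁻¹)
    (fun k hk => (hv k hk).smul σ⁻¹)
    (fun k hk => by
      filter_upwards [condExp_smul (μ := μ) σ⁻¹ (v k) (F k), h0 k hk] with ω h1 h2
      have h1' : (μ[fun ω => σ⁻¹ • v k ω | F k]) ω = σ⁻¹ • (μ[v k | F k]) ω := h1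
      rw [h1', h2]
      simp)
    (fun k hk => by simpa only [hnorm, div_pow] using hexp k hk)
    (fun k hk => by simpa only [hnorm, div_pow] using hle k hk) ht0 T le_rfl
  simp only [← Finset.smul_sum, hnorm] at hi hb
  set r : ℝ := 3 / 2 * (1 + lam) * √T with hr
  have hr0 : 0 ≤ r := by positivity
  have hmarkov := mul_meas_ge_le_integral_of_nonneg (μ := μ)
    (Filter.Eventually.of_forall fun ω => (Real.cosh_pos _).le) hi (Real.cosh (t * r))
  have hsub : {ω | 3 / 2 * (1 + lam) * σ * √T ≤ ‖∑ j ∈ Finset.range T, v j ω‖} ⊆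
      {ω | Real.cosh (t * r) ≤ Real.cosh (t * (‖∑ j ∈ Finset.range T, v j ω‖ / σ))} := by
    intro ω hω
    simp only [Set.mem_ofPred_eq] at hω ⊢
    rw [Real.cosh_le_cosh, abs_of_nonneg (by positivity), abs_of_nonneg (by positivity)]
    refine mul_le_mul_of_nonneg_left ?_ ht0.le
    rw [le_div_iff₀ hσ]
    exact hω.trans' (le_of_eq (by rw [hr]; ring))
  have h1 := measureReal_mono (μ := μ) hsub
  have htr : t * r = 45 / 32 * (1 + lam) ^ 2 := by
    rw [ht, hr]; field_simp; ring
  have htT : (T : ℝ) * (4 / 5 * t ^ 2) = 45 / 64 * (1 + lam) ^ 2 := by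
    rw [ht, div_pow, Real.sq_sqrt hT0.le]; field_simp; ring
  rw [← Real.exp_nat_mul, htT] at hb
  have h2 : Real.exp (t * r) / 2 ≤ Real.cosh (t * r) := by
    rw [Real.cosh_eq]; linarith [Real.exp_pos (-(t * r))]
  -- Since `log 2 < 45/64`, the factor 2 is paid by the constant term of `45/64 (1 + lam)²`; what
  -- remains, `45/64 (2 lam + lam²)`, exceeds `lam² / 3`.
  have hlog : (2 : ℝ) ≤ Real.exp (45 / 64) := by
    rw [← Real.log_le_iff_le_exp (by norm_num)]
    linarith [Real.log_two_lt_d9]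
  set p := μ.real {ω | 3 / 2 * (1 + lam) * σ * √T ≤ ‖∑ j ∈ Finset.range T, v j ω‖}
  have hp : 0 ≤ p := measureReal_nonneg
  have h3 : Real.exp (t * r) / 2 * p ≤ Real.exp (45 / 64 * (1 + lam) ^ 2) :=
    (mul_le_mul h2 h1 hp (Real.cosh_pos _).le).trans (hmarkov.trans hb)
  have h4 : p ≤ 2 * Real.exp (-(45 / 64 * (1 + lam) ^ 2)) := by
    have e : Real.exp (t * r)
        = Real.exp (45 / 64 * (1 + lam) ^ 2) * Real.exp (45 / 64 * (1 + lam) ^ 2) := by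
      rw [htr, ← Real.exp_add]; ring_nf
    rw [e] at h3
    rw [Real.exp_neg, ← div_eq_mul_inv, le_div_iff₀ (Real.exp_pos _)]
    have := Real.exp_pos (45 / 64 * (1 + lam) ^ 2)
    refine le_of_mul_le_mul_left ?_ this
    linarith
  calc p ≤ 2 * Real.exp (-(45 / 64 * (1 + lam) ^ 2)) := h4
    _ ≤ Real.exp (45 / 64) * Real.exp (-(45 / 64 * (1 + lam) ^ 2)) := by gcongr
    _ = Real.exp (45 / 64 + -(45 / 64 * (1 + lam) ^ 2)) := (Real.exp_add _ _).symm
    _ ≤ _ := Real.exp_le_exp.2 (by nlinarith)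

end Concentration

/-! ### Descent along the stochastic gradient iteration -/

section Descent

theorem BN_pos {E : Type*} {f : E → ℝ} {L σ : ℝ} {x₁ : E} {N : ℕ} (hL : 0 < L)
    (hσ : 0 < σ) {Dt : ℝ} (hDt : 0 < Dt) (hN : 1 ≤ N) : 0 < BN f L σ Dt x₁ N := by
  have : (0 : ℝ) < N := by exact_mod_cast hN
  have := Real.sqrt_pos.2 this
  rw [BN]
  positivity

variable {E : Type*} [NormedAddCommGroup E] [InnerProductSpace ℝ E] [CompleteSpace E]

theorem continuous_gradient_of_lipschitz {f : E → ℝ} {L : ℝ} (hL : 0 < L)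
    (hlip : ∀ x y, ‖gradient f y - gradient f x‖ ≤ L * ‖y - x‖) : Continuous (gradient f) := by
  refine (LipschitzWith.of_dist_le_mul (K := ⟨L, hL.le⟩) fun x y => ?_).continuous
  rw [dist_eq_norm, dist_eq_norm]
  exact hlip y x

/-- The descent lemma for functions with Lipschitz continuous gradient. -/
theorem le_add_inner_gradient_add_sq {f : E → ℝ} {L : ℝ} (hf : Differentiable ℝ f)
    (hlip : ∀ x y, ‖gradient f y - gradient f x‖ ≤ L * ‖y - x‖) (x v : E) :
    f (x + v) ≤ f x + inner ℝ (gradient f x) v + L / 2 * ‖v‖ ^ 2 := by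
  -- The gap between `f` and its quadratic model along the segment; the Lipschitz condition makes
  -- its derivative nonpositive.
  set φ : ℝ → ℝ := fun t => f (x + t • v) - t * inner ℝ (gradient f x) v - L / 2 * t ^ 2 * ‖v‖ ^ 2
    with hφ
  have hderiv (t : ℝ) : HasDerivAt φ (inner ℝ (gradient f (x + t • v)) v
      - inner ℝ (gradient f x) v - L * t * ‖v‖ ^ 2) t := by
    have h1 : HasDerivAt (fun t : ℝ => x + t • v) v t := by
      simpa using ((hasDerivAt_id t).smul_const v).const_add x
    have h2 := (hf (x + t • v)).hasGradientAt.hasFDerivAt.comp_hasDerivAt t h1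
    have h3 := ((hasDerivAt_id t).mul_const (inner ℝ (gradient f x) v))
    have h4 := (((hasDerivAt_id t).pow 2).const_mul (L / 2)).mul_const (‖v‖ ^ 2)
    convert! (h2.sub h3).sub h4 using 1
    simp only [InnerProductSpace.toDual_apply_apply, id_eq, Nat.cast_ofNat, Nat.reduceSub]
    ring
  have hanti : AntitoneOn φ (Set.Icc 0 1) := by
    refine antitoneOn_of_deriv_nonpos (convex_Icc 0 1)
      (fun t _ => (hderiv t).continuousAt.continuousWithinAt)
      (fun t _ => (hderiv t).differentiableAt.differentiableWithinAt) fun t ht => ?_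
    rw [interior_Icc] at ht
    rw [(hderiv t).deriv, ← inner_sub_left]
    have h1 := real_inner_le_norm (gradient f (x + t • v) - gradient f x) v
    have h2 := hlip x (x + t • v)
    rw [add_sub_cancel_left, norm_smul, Real.norm_of_nonneg ht.1.le] at h2
    have h3 := mul_le_mul_of_nonneg_right h2 (norm_nonneg v)
    nlinarith
  have h := hanti (Set.left_mem_Icc.2 zero_le_one) (Set.right_mem_Icc.2 zero_le_one) zero_le_one
  simp only [hφ, one_smul, zero_smul, add_zero] at h
  linarith

/-- Telescoped descent lemma with `g k` split into gradient and noise: the inner product has mean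
zero, and only the squared noise survives integration. -/
theorem le_sum_descent {f : E → ℝ} {L : ℝ} {γ : ℕ → ℝ} (hf : Differentiable ℝ f)
    (hlip : ∀ x y, ‖gradient f y - gradient f x‖ ≤ L * ‖y - x‖) (x : ℕ → E) (g : ℕ → E)
    (hx : ∀ k, x (k + 1) = x k - γ (k + 1) • g k) (n : ℕ) :
    ∑ k ∈ Finset.range n, (γ (k + 1) - L / 2 * γ (k + 1) ^ 2) * ‖gradient f (x k)‖ ^ 2
      ≤ f (x 0) - f (x n) + ∑ k ∈ Finset.range n,
        ((L * γ (k + 1) ^ 2 - γ (k + 1)) * inner ℝ (gradient f (x k)) (g k - gradient f (x k))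
          + L / 2 * γ (k + 1) ^ 2 * ‖g k - gradient f (x k)‖ ^ 2) := by
  induction n with
  | zero => simp
  | succ n ih =>
    rw [Finset.sum_range_succ, Finset.sum_range_succ]
    have h := le_add_inner_gradient_add_sq hf hlip (x n) (-(γ (n + 1) • g n))
    rw [← sub_eq_add_neg, ← hx, inner_neg_right, real_inner_smul_right, norm_neg, norm_smul,
      mul_pow, Real.norm_eq_abs, sq_abs] at h
    obtain ⟨v, hv⟩ : ∃ v, g n = gradient f (x n) + v := ⟨g n - gradient f (x n), by simp⟩
    rw [hv, inner_add_right, norm_add_sq_real, real_inner_self_eq_norm_sq] at h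
    rw [hv, add_sub_cancel_left]
    linarith

theorem memLp_gradient {Ω : Type*} {m0 : MeasurableSpace Ω} {μ : Measure Ω} [IsFiniteMeasure μ]
    {f : E → ℝ} {L : ℝ} (hlip : ∀ x y, ‖gradient f y - gradient f x‖ ≤ L * ‖y - x‖)
    (hgrad : Continuous (gradient f)) {X : Ω → E} (hX : MemLp X 2 μ) :
    MemLp (fun ω => gradient f (X ω)) 2 μ := by
  have h : MemLp (fun ω => gradient f (X ω) - gradient f 0) 2 μ :=
    hX.of_le_mul (c := L) ((hgrad.comp_aestronglyMeasurable hX.1).sub aestronglyMeasurable_const)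
      (Filter.Eventually.of_forall fun ω => by simpa using hlip 0 (X ω))
  exact (h.add (memLp_const (gradient f 0))).ae_eq
    (Filter.Eventually.of_forall fun ω => by simp)

end Descent

/-! ### Measurability of the iterates -/

section Measurability

variable {E Ξ Ω : Type*} [NormedAddCommGroup E] [InnerProductSpace ℝ E]
  [MeasurableSpace E] [BorelSpace E] [SecondCountableTopology E] [MeasurableSpace Ξ]
  {G : E → Ξ → E}

/-- The σ-algebra `m` is left free so that the result serves the whole space, the past of a call and
the space of input sequences alike. -/
theorem measurable_sgLoop (hG : Measurable (fun p : E × Ξ => G p.1 p.2)) (γ : ℕ → ℝ) (x₁ : E)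
    {m : MeasurableSpace Ω} {ξ : ℕ → Ω → Ξ} :
    ∀ k : ℕ, (∀ j ∈ Finset.Icc 1 k, Measurable[m] (ξ j)) →
      Measurable[m] fun ω => (sgLoop G γ x₁ (fun j => ξ j ω) k).1 := by
  intro k
  induction k with
  | zero => intro _; exact measurable_const
  | succ k ih =>
    intro h
    have h1 := ih fun j hj => h j (Finset.Icc_subset_Icc_right (Nat.le_succ k) hj)
    have h2 := h (k + 1) (by simp)
    exact h1.sub ((hG.comp (h1.prodMk h2)).const_smul _)

theorem measurable_searchPoint_stop (hG : Measurable (fun p : E × Ξ => G p.1 p.2)) (γ : ℕ → ℝ)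
    (x₁ : E) {m : MeasurableSpace Ω} {ξ : ℕ → Ω → Ξ} {N : ℕ} {R : Ω → ℕ}
    (hR : Measurable[m] R) (hRN : ∀ ω, R ω ≤ N) (hξ : ∀ j ∈ Finset.Icc 1 N, Measurable[m] (ξ j)) :
    Measurable[m] fun ω => searchPoint G γ x₁ (fun j => ξ j ω) (R ω) := by
  -- Truncating at `N` makes every section measurable with the inputs up to `N` alone, and changes
  -- nothing along `R`.
  have h : Measurable fun p : ℕ × Ω => searchPoint G γ x₁ (fun j => ξ j p.2) (min p.1 N) := by
    refine measurable_from_prod_countable_right fun k => ?_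
    refine measurable_sgLoop hG γ x₁ (min k N - 1) fun j hj => hξ j ?_
    simp only [Finset.mem_Icc] at hj ⊢
    omega
  have h' := h.comp (hR.prodMk measurable_id)
  have e : (fun ω => searchPoint G γ x₁ (fun j => ξ j ω) (R ω))
      = (fun p : ℕ × Ω => searchPoint G γ x₁ (fun j => ξ j p.2) (min p.1 N)) ∘
        fun ω => (R ω, ω) := by
    funext ω
    simp [hRN ω]
  rw [e]
  exact h'

theorem measurable_sigmaBefore {ξ : ℕ → Ω → Ξ} {j k : ℕ} (hj : j ∈ Finset.Ico 1 k) :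
    Measurable[sigmaBefore ξ k] (ξ j) :=
  (comap_measurable (ξ j)).mono (le_iSup₂_of_le j hj le_rfl) le_rfl

theorem sigmaBefore_le {m0 : MeasurableSpace Ω} {ξ : ℕ → Ω → Ξ} (hξ : ∀ j, Measurable (ξ j))
    (k : ℕ) : sigmaBefore ξ k ≤ m0 :=
  iSup₂_le fun j _ => (hξ j).comap_le

theorem measurable_searchPoint (hG : Measurable (fun p : E × Ξ => G p.1 p.2)) (γ : ℕ → ℝ)
    (x₁ : E) (ξ : ℕ → Ω → Ξ) {k : ℕ} (hk : 1 ≤ k) :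
    Measurable[sigmaBefore ξ k] fun ω => searchPoint G γ x₁ (fun j => ξ j ω) k := by
  refine measurable_sgLoop hG γ x₁ _ fun j hj => measurable_sigmaBefore ?_
  simp only [Finset.mem_Icc, Finset.mem_Ico] at hj ⊢
  omega

end Measurability

/-! ### Consequences of the assumptions for a single oracle call -/

section Oracle

variable {E Ξ Ω : Type*} [NormedAddCommGroup E] [InnerProductSpace ℝ E] [CompleteSpace E]
  [MeasurableSpace E] [BorelSpace E] [SecondCountableTopology E] [MeasurableSpace Ξ]
  {H m0 : MeasurableSpace Ω} {μ : Measure Ω} {f : E → ℝ} {G : E → Ξ → E} {σ : ℝ}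
  {X : Ω → E} {ξ : Ω → Ξ}

theorem A1.memLp_error (h : A1 μ f G σ H X ξ) (hG : Measurable (fun p : E × Ξ => G p.1 p.2))
    (hgrad : Continuous (gradient f)) (hX : Measurable X) (hξ : Measurable ξ) :
    MemLp (fun ω => G (X ω) (ξ ω) - gradient f (X ω)) 2 μ := by
  have hm : Measurable fun ω => G (X ω) (ξ ω) - gradient f (X ω) :=
    (hG.comp (hX.prodMk hξ)).sub (hgrad.measurable.comp hX)
  rw [← memLp_norm_iff hm.aestronglyMeasurable,
    memLp_two_iff_integrable_sq hm.norm.aestronglyMeasurable]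
  refine ⟨(hm.norm.pow_const 2).aestronglyMeasurable, ?_⟩
  rw [hasFiniteIntegral_iff_ofReal (Filter.Eventually.of_forall fun ω => sq_nonneg _)]
  exact h.2.2.trans_lt ENNReal.ofReal_lt_top

theorem A1.integral_sq_le (h : A1 μ f G σ H X ξ) (hG : Measurable (fun p : E × Ξ => G p.1 p.2))
    (hgrad : Continuous (gradient f)) (hX : Measurable X) (hξ : Measurable ξ) :
    ∫ ω, ‖G (X ω) (ξ ω) - gradient f (X ω)‖ ^ 2 ∂μ ≤ σ ^ 2 := by
  have hm : Measurable fun ω => G (X ω) (ξ ω) - gradient f (X ω) :=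
    (hG.comp (hX.prodMk hξ)).sub (hgrad.measurable.comp hX)
  rw [integral_eq_lintegral_of_nonneg_ae (Filter.Eventually.of_forall fun ω => sq_nonneg _)
    (hm.norm.pow_const 2).aestronglyMeasurable]
  exact ENNReal.toReal_le_of_le_ofReal (sq_nonneg σ) h.2.2

theorem A1.integrable_error [IsFiniteMeasure μ] (h : A1 μ f G σ H X ξ)
    (hG : Measurable (fun p : E × Ξ => G p.1 p.2))
    (hgrad : Continuous (gradient f)) (hX : Measurable X) (hξ : Measurable ξ) :
    Integrable (fun ω => G (X ω) (ξ ω) - gradient f (X ω)) μ :=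
  (h.memLp_error hG hgrad hX hξ).integrable (by norm_num)

theorem A1.condExp_error [IsFiniteMeasure μ] (h : A1 μ f G σ H X ξ) (hH : H ≤ m0)
    (hG : Measurable (fun p : E × Ξ => G p.1 p.2)) (hgrad : Continuous (gradient f))
    (hX : Measurable[H] X) (hξ : Measurable ξ) :
    μ[fun ω => G (X ω) (ξ ω) - gradient f (X ω) | H] =ᵐ[μ] 0 := by
  have hv := h.integrable_error hG hgrad (hX.mono hH le_rfl) hξ
  -- No moment of `X` is assumed: the gradient is the difference of the integrable oracle answer and
  -- its integrable error.
  have hg : Integrable (fun ω => gradient f (X ω)) μ := by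
    refine (h.1.sub hv).congr (Filter.Eventually.of_forall fun ω => ?_)
    simp
  have hs : StronglyMeasurable[H] fun ω => gradient f (X ω) :=
    (hgrad.measurable.comp hX).stronglyMeasurable
  have h1 := condExp_sub h.1 hg H
  rw [condExp_of_stronglyMeasurable hH hs hg] at h1
  filter_upwards [h1, h.2.1] with ω h1 h2
  have h1' : (μ[fun ω => G (X ω) (ξ ω) - gradient f (X ω) | H]) ω = _ := h1
  rw [h1', Pi.sub_apply, h2]
  simp

end Oracle

/-! ### Expected accuracy of one RSG run -/

section Rsg

variable {E Ξ Ω : Type*} [NormedAddCommGroup E] [InnerProductSpace ℝ E] [CompleteSpace E]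
  [MeasurableSpace E] [BorelSpace E] [SecondCountableTopology E] [MeasurableSpace Ξ]
  {m0 : MeasurableSpace Ω} {μ : Measure Ω} [IsProbabilityMeasure μ] {f : E → ℝ} {G : E → Ξ → E}
  {L σ : ℝ} {γ : ℕ → ℝ} {x₁ : E} {ξ : ℕ → Ω → Ξ} {N : ℕ}

/-- A Lipschitz gradient grows at most linearly and the noise is square integrable, so square
integrability propagates; it makes the products of gradient and noise integrable. -/
theorem memLp_searchPoint (hG : Measurable (fun p : E × Ξ => G p.1 p.2))
    (hlip : ∀ x y, ‖gradient f y - gradient f x‖ ≤ L * ‖y - x‖)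
    (hgrad : Continuous (gradient f)) (hξ : ∀ k, Measurable (ξ k))
    (hA : ∀ k ∈ Finset.Icc 1 N, A1 μ f G σ (sigmaBefore ξ k)
      (fun ω => searchPoint G γ x₁ (fun j => ξ j ω) k) (ξ k)) :
    ∀ k < N, MemLp (fun ω => searchPoint G γ x₁ (fun j => ξ j ω) (k + 1)) 2 μ := by
  intro k
  induction k with
  | zero => intro _; exact memLp_const x₁
  | succ k ih =>
    intro hk
    have h1 := ih (by omega)
    have h2 := memLp_gradient hlip hgrad h1
    have h3 := (hA (k + 1) (by simp; omega)).memLp_error hG hgrad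
      ((measurable_searchPoint hG γ x₁ ξ (by omega)).mono (sigmaBefore_le hξ _) le_rfl) (hξ _)
    have h4 := h1.sub ((h2.add h3).const_smul (γ (k + 1)))
    refine h4.ae_eq (Filter.Eventually.of_forall fun ω => ?_)
    simp only [searchPoint, sgLoop, add_tsub_cancel_right, Pi.sub_apply, Pi.smul_apply,
      Pi.add_apply, add_sub_cancel]

/-- The expected squared gradient norms along the stochastic gradient iteration. -/
theorem sum_integral_sq_gradient_le (hL : 0 < L) (hf : Differentiable ℝ f)
    (hbdd : BddBelow (Set.range f))
    (hG : Measurable (fun p : E × Ξ => G p.1 p.2))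
    (hlip : ∀ x y, ‖gradient f y - gradient f x‖ ≤ L * ‖y - x‖) (hξ : ∀ k, Measurable (ξ k))
    (hA : ∀ k ∈ Finset.Icc 1 N, A1 μ f G σ (sigmaBefore ξ k)
      (fun ω => searchPoint G γ x₁ (fun j => ξ j ω) k) (ξ k)) :
    ∑ k ∈ Finset.Icc 1 N, (2 * γ k - L * γ k ^ 2) *
        ∫ ω, ‖gradient f (searchPoint G γ x₁ (fun j => ξ j ω) k)‖ ^ 2 ∂μ
      ≤ L * Df f L x₁ ^ 2 + L * σ ^ 2 * ∑ k ∈ Finset.Icc 1 N, γ k ^ 2 := by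
  have hgrad := continuous_gradient_of_lipschitz hL hlip
  set x : ℕ → Ω → E := fun k ω => searchPoint G γ x₁ (fun j => ξ j ω) (k + 1) with hxdef
  set v : ℕ → Ω → E := fun k ω => G (x k ω) (ξ (k + 1) ω) - gradient f (x k ω) with hvdef
  have hxm (k : ℕ) : Measurable[sigmaBefore ξ (k + 1)] (x k) :=
    measurable_searchPoint hG γ x₁ ξ (by omega)
  have hxm0 (k : ℕ) : Measurable (x k) := (hxm k).mono (sigmaBefore_le hξ _) le_rfl
  have hA' (k : ℕ) (hk : k < N) : A1 μ f G σ (sigmaBefore ξ (k + 1)) (x k) (ξ (k + 1)) :=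
    hA (k + 1) (by simp; omega)
  have hx2 (k : ℕ) (hk : k < N) : MemLp (x k) 2 μ := memLp_searchPoint hG hlip hgrad hξ hA k hk
  have hg2 (k : ℕ) (hk : k < N) : MemLp (fun ω => gradient f (x k ω)) 2 μ :=
    memLp_gradient hlip hgrad (hx2 k hk)
  have hv2 (k : ℕ) (hk : k < N) : MemLp (v k) 2 μ :=
    (hA' k hk).memLp_error hG hgrad (hxm0 k) (hξ _)
  have hin (k : ℕ) (hk : k < N) : Integrable (fun ω => inner ℝ (gradient f (x k ω)) (v k ω)) μ := by
    refine ((hg2 k hk).norm.integrable_mul (hv2 k hk).norm).mono'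
      ((hg2 k hk).1.inner (hv2 k hk).1) (Filter.Eventually.of_forall fun ω => ?_)
    exact norm_inner_le_norm _ _
  have hin0 (k : ℕ) (hk : k < N) : ∫ ω, inner ℝ (gradient f (x k ω)) (v k ω) ∂μ = 0 :=
    integral_inner_eq_zero_of_condExp_eq_zero (sigmaBefore_le hξ (k + 1))
      (hgrad.measurable.comp (hxm k)).stronglyMeasurable ((hv2 k hk).integrable (by norm_num))
      (hin k hk) ((hA' k hk).condExp_error (sigmaBefore_le hξ _) hG hgrad (hxm k) (hξ _))
  have hgi (k : ℕ) (hk : k < N) : Integrable (fun ω => ‖gradient f (x k ω)‖ ^ 2) μ :=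
    (hg2 k hk).integrable_norm_pow (by norm_num)
  have hvi (k : ℕ) (hk : k < N) : Integrable (fun ω => ‖v k ω‖ ^ 2) μ :=
    (hv2 k hk).integrable_norm_pow (by norm_num)
  have hbi (k : ℕ) (hk : k < N) : Integrable (fun ω =>
      (L * γ (k + 1) ^ 2 - γ (k + 1)) * inner ℝ (gradient f (x k ω)) (v k ω)
        + L / 2 * γ (k + 1) ^ 2 * ‖v k ω‖ ^ 2) μ :=
    ((hin k hk).const_mul _).add ((hvi k hk).const_mul _)
  have hpath (ω : Ω) : ∑ k ∈ Finset.range N,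
        (γ (k + 1) - L / 2 * γ (k + 1) ^ 2) * ‖gradient f (x k ω)‖ ^ 2
      ≤ (f x₁ - ⨅ x, f x) + ∑ k ∈ Finset.range N,
        ((L * γ (k + 1) ^ 2 - γ (k + 1)) * inner ℝ (gradient f (x k ω)) (v k ω)
          + L / 2 * γ (k + 1) ^ 2 * ‖v k ω‖ ^ 2) := by
    have h := le_sum_descent (γ := γ) hf hlip (fun k => x k ω)
      (fun k => G (x k ω) (ξ (k + 1) ω)) (fun k => rfl) N
    have h' := ciInf_le hbdd (x N ω)
    have e : x 0 ω = x₁ := rfl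
    simp only [e] at h
    linarith
  have hint := integral_mono
    (integrable_finsetSum _ fun k hk => (hgi k (Finset.mem_range.1 hk)).const_mul _)
    ((integrable_const _).add
      (integrable_finsetSum _ fun k hk => hbi k (Finset.mem_range.1 hk))) hpath
  have hl : ∫ ω, ∑ k ∈ Finset.range N,
        (γ (k + 1) - L / 2 * γ (k + 1) ^ 2) * ‖gradient f (x k ω)‖ ^ 2 ∂μ
      = ∑ k ∈ Finset.range N,
        (γ (k + 1) - L / 2 * γ (k + 1) ^ 2) * ∫ ω, ‖gradient f (x k ω)‖ ^ 2 ∂μ := by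
    rw [integral_finsetSum _ fun k hk => (hgi k (Finset.mem_range.1 hk)).const_mul _]
    simp only [integral_const_mul]
  have hr : ∫ ω, ((f x₁ - ⨅ x, f x) + ∑ k ∈ Finset.range N,
        ((L * γ (k + 1) ^ 2 - γ (k + 1)) * inner ℝ (gradient f (x k ω)) (v k ω)
          + L / 2 * γ (k + 1) ^ 2 * ‖v k ω‖ ^ 2)) ∂μ
      ≤ (f x₁ - ⨅ x, f x) + ∑ k ∈ Finset.range N, L / 2 * γ (k + 1) ^ 2 * σ ^ 2 := by
    rw [integral_add (integrable_const _)
        (integrable_finsetSum _ fun k hk => hbi k (Finset.mem_range.1 hk)),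
      integral_finsetSum _ fun k hk => hbi k (Finset.mem_range.1 hk)]
    simp only [integral_const, probReal_univ, one_smul]
    gcongr with k hk
    have hk' := Finset.mem_range.1 hk
    rw [integral_add ((hin k hk').const_mul _) ((hvi k hk').const_mul _), integral_const_mul,
      integral_const_mul, hin0 k hk', mul_zero, zero_add]
    exact mul_le_mul_of_nonneg_left ((hA' k hk').integral_sq_le hG hgrad (hxm0 k) (hξ _))
      (by positivity)
  have hfin := hl.symm.le.trans (hint.trans hr)
  have hDf : L * Df f L x₁ ^ 2 = 2 * (f x₁ - ⨅ x, f x) := by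
    have : 0 ≤ f x₁ - ⨅ x, f x := sub_nonneg.2 (ciInf_le hbdd x₁)
    rw [Df, Real.sq_sqrt (by positivity)]
    field_simp
  have hshift (F : ℕ → ℝ) : ∑ k ∈ Finset.Icc 1 N, F k = ∑ k ∈ Finset.range N, F (k + 1) := by
    rw [Finset.range_eq_Ico, Finset.sum_Ico_add' F 0 N 1]
    rfl
  rw [hshift, hshift, hDf, Finset.mul_sum]
  calc ∑ k ∈ Finset.range N, (2 * γ (k + 1) - L * γ (k + 1) ^ 2) *
        ∫ ω, ‖gradient f (x k ω)‖ ^ 2 ∂μ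
      = 2 * ∑ k ∈ Finset.range N, (γ (k + 1) - L / 2 * γ (k + 1) ^ 2) *
          ∫ ω, ‖gradient f (x k ω)‖ ^ 2 ∂μ := by
        rw [Finset.mul_sum]; exact Finset.sum_congr rfl fun k _ => by ring
    _ ≤ 2 * ((f x₁ - ⨅ x, f x) + ∑ k ∈ Finset.range N, L / 2 * γ (k + 1) ^ 2 * σ ^ 2) := by
        linarith
    _ = _ := by
        rw [mul_add, Finset.mul_sum]
        congr 1
        exact Finset.sum_congr rfl fun k _ => by ring

/-- The expected squared gradient norm at the output of the RSG method. -/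
theorem integral_sq_gradient_stop (hL : 0 < L)
    (hG : Measurable (fun p : E × Ξ => G p.1 p.2))
    (hlip : ∀ x y, ‖gradient f y - gradient f x‖ ≤ L * ‖y - x‖) (hξ : ∀ k, Measurable (ξ k))
    (hA : ∀ k ∈ Finset.Icc 1 N, A1 μ f G σ (sigmaBefore ξ k)
      (fun ω => searchPoint G γ x₁ (fun j => ξ j ω) k) (ξ k))
    {R : Ω → ℕ} (hR : Measurable R) (hRN : ∀ ω, R ω ∈ Finset.Icc 1 N)
    (hind : IndepFun R (fun ω k => ξ k ω) μ) :
    Integrable (fun ω => ‖gradient f (searchPoint G γ x₁ (fun j => ξ j ω) (R ω))‖ ^ 2) μ ∧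
    ∫ ω, ‖gradient f (searchPoint G γ x₁ (fun j => ξ j ω) (R ω))‖ ^ 2 ∂μ
      = ∑ k ∈ Finset.Icc 1 N, μ.real {ω | R ω = k} *
        ∫ ω, ‖gradient f (searchPoint G γ x₁ (fun j => ξ j ω) k)‖ ^ 2 ∂μ := by
  have hgrad := continuous_gradient_of_lipschitz hL hlip
  -- For fixed `k` the squared norm depends only on the input sequence, hence is independent of `R`.
  set φ : ℕ → (ℕ → Ξ) → ℝ := fun k z => ‖gradient f (searchPoint G γ x₁ z k)‖ ^ 2 with hφ
  have hφm (k : ℕ) : Measurable (φ k) :=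
    ((hgrad.measurable.comp (measurable_sgLoop hG γ x₁ (ξ := fun j (z : ℕ → Ξ) => z j) (k - 1)
      fun j _ => measurable_pi_apply j)).norm).pow_const 2
  have hφi (k : ℕ) (hk : k ∈ Finset.Icc 1 N) : Integrable (fun ω => φ k fun j => ξ j ω) μ := by
    rw [Finset.mem_Icc] at hk
    obtain ⟨l, rfl⟩ : ∃ l, k = l + 1 := ⟨k - 1, by omega⟩
    exact (memLp_gradient hlip hgrad (memLp_searchPoint hG hlip hgrad hξ hA l
      (by omega))).integrable_norm_pow (by norm_num)
  have hind1 (k : ℕ) : Measurable (Set.indicator {k} (1 : ℕ → ℝ)) := measurable_from_top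
  have hmul (k : ℕ) : IndepFun (fun ω => Set.indicator {k} (1 : ℕ → ℝ) (R ω))
      (fun ω => φ k fun j => ξ j ω) μ := hind.comp (hind1 k) (hφm k)
  have hI (k : ℕ) : Integrable (fun ω => Set.indicator {k} (1 : ℕ → ℝ) (R ω)) μ := by
    refine Integrable.of_bound ((hind1 k).comp hR).aestronglyMeasurable 1
      (Filter.Eventually.of_forall fun ω => ?_)
    by_cases h : R ω = k <;> simp [h]
  have hIv (k : ℕ) : ∫ ω, Set.indicator {k} (1 : ℕ → ℝ) (R ω) ∂μ = μ.real {ω | R ω = k} :=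
    integral_indicator_one (hR (measurableSet_singleton k))
  have hsum (ω : Ω) : φ (R ω) (fun j => ξ j ω)
      = ∑ k ∈ Finset.Icc 1 N, Set.indicator {k} (1 : ℕ → ℝ) (R ω) * φ k fun j => ξ j ω := by
    rw [Finset.sum_eq_single_of_mem (R ω) (hRN ω)]
    · simp
    · intro k _ hk
      simp [hk.symm]
  have hprod (k : ℕ) (hk : k ∈ Finset.Icc 1 N) : Integrable
      (fun ω => Set.indicator {k} (1 : ℕ → ℝ) (R ω) * φ k fun j => ξ j ω) μ :=
    (hmul k).integrable_mul (hI k) (hφi k hk)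
  have e : (fun ω => φ (R ω) (fun j => ξ j ω)) = fun ω =>
      ∑ k ∈ Finset.Icc 1 N, Set.indicator {k} (1 : ℕ → ℝ) (R ω) * φ k fun j => ξ j ω := funext hsum
  change Integrable (fun ω => φ (R ω) (fun j => ξ j ω)) μ ∧
    ∫ ω, φ (R ω) (fun j => ξ j ω) ∂μ = _
  rw [e]
  refine ⟨integrable_finsetSum _ hprod, ?_⟩
  rw [integral_finsetSum _ hprod]
  refine Finset.sum_congr rfl fun k hk => ?_
  rw [(hmul k).integral_fun_mul_eq_mul_integral (hI k).1 (hφi k hk).1, hIv]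

/-- The bound `E ‖∇f(x_R)‖² ≤ L B_N` for the RSG method with the stepsizes `stepsize`. -/
theorem integral_sq_gradient_stop_le (hL : 0 < L) (hσ : 0 < σ) {Dt : ℝ} (hDt : 0 < Dt)
    (hN : 1 ≤ N) (hf : Differentiable ℝ f) (hbdd : BddBelow (Set.range f))
    (hG : Measurable (fun p : E × Ξ => G p.1 p.2))
    (hlip : ∀ x y, ‖gradient f y - gradient f x‖ ≤ L * ‖y - x‖) (hξ : ∀ k, Measurable (ξ k))
    (hA : ∀ k ∈ Finset.Icc 1 N, A1 μ f G σ (sigmaBefore ξ k)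
      (fun ω => searchPoint G (stepsize L σ Dt N) x₁ (fun j => ξ j ω) k) (ξ k))
    {R : Ω → ℕ} (hR : Measurable R) (hRN : ∀ ω, R ω ∈ Finset.Icc 1 N)
    (hlaw : ∀ k ∈ Finset.Icc 1 N, μ.real {ω | R ω = k} = stopPmf L (stepsize L σ Dt N) N k)
    (hind : IndepFun R (fun ω k => ξ k ω) μ) :
    ∫ ω, ‖gradient f (searchPoint G (stepsize L σ Dt N) x₁ (fun j => ξ j ω) (R ω))‖ ^ 2 ∂μ
      ≤ L * BN f L σ Dt x₁ N := by
  have hN0 : (0 : ℝ) < N := by exact_mod_cast hN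
  have hsN : 0 < √(N : ℝ) := Real.sqrt_pos.2 hN0
  have hNs : (N : ℝ) = √(N : ℝ) * √(N : ℝ) := (Real.mul_self_sqrt hN0.le).symm
  obtain ⟨c, hc⟩ : ∃ c, c = min (1 / L) (Dt / (σ * √(N : ℝ))) := ⟨_, rfl⟩
  have hγ (k : ℕ) : stepsize L σ Dt N k = c := hc.symm
  have hc0 : 0 < c := by rw [hc]; exact lt_min (by positivity) (by positivity)
  have hcL : L * c ≤ 1 := by
    have : c ≤ 1 / L := hc ▸ min_le_left _ _
    rwa [le_div_iff₀ hL, mul_comm] at this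
  have hcD : c ≤ Dt / (σ * √(N : ℝ)) := hc ▸ min_le_right _ _
  -- The reciprocal of a minimum is the maximum of the reciprocals, bounded here by their sum.
  have hcinv : 1 / c ≤ L + σ * √(N : ℝ) / Dt := by
    have h1 : 0 ≤ σ * √(N : ℝ) / Dt := by positivity
    rcases min_choice (1 / L) (Dt / (σ * √(N : ℝ))) with h | h
    · rw [hc, h, one_div_one_div]; linarith
    · rw [hc, h, one_div_div]; linarith
  have hs := sum_integral_sq_gradient_le hL hf hbdd hG hlip hξ hA
  rw [(integral_sq_gradient_stop hL hG hlip hξ hA hR hRN hind).2]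
  simp only [hγ, Finset.sum_const, Nat.card_Icc, add_tsub_cancel_right, nsmul_eq_mul] at hs
  rw [Finset.sum_congr rfl fun k hk => by rw [hlaw k hk, stopPmf]]
  simp only [hγ, Finset.sum_const, Nat.card_Icc, add_tsub_cancel_right, nsmul_eq_mul]
  set I : ℕ → ℝ := fun k =>
    ∫ ω, ‖gradient f (searchPoint G (stepsize L σ Dt N) x₁ (fun j => ξ j ω) k)‖ ^ 2 ∂μ
  -- Since `L c ≤ 1`, the stopping weights are at least the stepsize.
  have hw : c ≤ 2 * c - L * c ^ 2 := by nlinarith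
  have hw0 : 0 < 2 * c - L * c ^ 2 := hc0.trans_le hw
  have e : ∑ k ∈ Finset.Icc 1 N, (2 * c - L * c ^ 2) / (N * (2 * c - L * c ^ 2)) * I k
      = (∑ k ∈ Finset.Icc 1 N, (2 * c - L * c ^ 2) * I k) / (N * (2 * c - L * c ^ 2)) := by
    rw [Finset.sum_div]
    exact Finset.sum_congr rfl fun k _ => by ring
  change ∑ k ∈ Finset.Icc 1 N, (2 * c - L * c ^ 2) / (N * (2 * c - L * c ^ 2)) * I k ≤ _
  rw [e]
  set D := Df f L x₁ ^ 2 with hD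
  have hD0 : 0 ≤ D := sq_nonneg _
  calc _ ≤ (L * D + L * σ ^ 2 * (N * c ^ 2)) / (N * (2 * c - L * c ^ 2)) :=
        div_le_div_of_nonneg_right hs (by positivity)
    _ ≤ (L * D + L * σ ^ 2 * (N * c ^ 2)) / (N * c) := by gcongr
    _ = L * D / N * (1 / c) + L * σ ^ 2 * c := by field_simp
    _ ≤ L * D / N * (L + σ * √(N : ℝ) / Dt) + L * σ ^ 2 * (Dt / (σ * √(N : ℝ))) := by gcongr
    _ = L * BN f L σ Dt x₁ N := by
        rw [BN, ← hD]
        generalize √(N : ℝ) = q at *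
        rw [hNs]
        field_simp
        ring

end Rsg

/-! ### Averaging, selection and the count of oracle calls -/

section Algorithm

variable {E Ξ Ω : Type*} [NormedAddCommGroup E] [NormedSpace ℝ E] {G : E → Ξ → E} {x₁ : E}
  {S N T : ℕ}

theorem gradSum_eq {E : Type*} [AddCommGroup E] {G : E → Ξ → E} (x : E) (ζ : ℕ → Ξ) (T : ℕ) :
    gradSum G x ζ T = (∑ j ∈ Finset.range T, G x (ζ (j + 1)), T) := by
  induction T with
  | zero => rfl
  | succ T ih => simp [gradSum, ih, Finset.sum_range_succ]

theorem norm_gradEst_sub (hT : 1 ≤ T) (x g : E) (ζ : ℕ → Ξ) :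
    ‖(gradEst G x ζ T).1 - g‖ = ‖∑ j ∈ Finset.range T, (G x (ζ (j + 1)) - g)‖ / T := by
  have hT0 : (0 : ℝ) < T := by exact_mod_cast hT
  have e : (gradEst G x ζ T).1 - g
      = (1 / (T : ℝ)) • ∑ j ∈ Finset.range T, (G x (ζ (j + 1)) - g) := by
    rw [Finset.sum_sub_distrib, smul_sub, Finset.sum_const, Finset.card_range, gradEst, gradSum_eq,
      ← Nat.cast_smul_eq_nsmul ℝ, smul_smul, one_div, inv_mul_cancel₀ hT0.ne', one_smul]
  rw [e, norm_smul, Real.norm_of_nonneg (by positivity)]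
  ring

/-- A candidate with smallest estimated gradient inherits the quality of the best candidate. -/
theorem sq_norm_lt_of_argmin {ι E : Type*} [SeminormedAddCommGroup E] {g d : ι → E} {p : ι}
    {A B : ℝ} (hmin : ∀ s, ‖g p‖ ≤ ‖g s‖) (hA : ∃ s, ‖d s‖ ^ 2 < A) (hB : ∀ s, ‖g s - d s‖ ^ 2 < B) :
    ‖d p‖ ^ 2 < 4 * A + 16 / 3 * B := by
  obtain ⟨s, hs⟩ := hA
  have h1 : ‖d p‖ ≤ ‖g p‖ + ‖g p - d p‖ := by
    have := norm_sub_norm_le (d p) (g p)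
    rw [norm_sub_rev] at this
    linarith
  have h2 : ‖g s‖ ≤ ‖d s‖ + ‖g s - d s‖ := by
    linarith [norm_sub_norm_le (g s) (d s)]
  have h3 : ‖d p‖ ≤ ‖d s‖ + ‖g s - d s‖ + ‖g p - d p‖ := by linarith [hmin s]
  have h4 := pow_le_pow_left₀ (norm_nonneg _) h3 2
  have h5 := hB s
  have h6 := hB p
  -- The weighted bound `(a + b + c)² ≤ 4 a² + 8/3 (b² + c²)`; the gap is `(3a - b - c)² / 3 + 4 (b
  -- - c)² / 3`.
  nlinarith [sq_nonneg (‖g s - d s‖ - ‖g p - d p‖),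
    sq_nonneg (3 * ‖d s‖ - ‖g s - d s‖ - ‖g p - d p‖)]

theorem sgLoop_calls (γ : ℕ → ℝ) (ξ : ℕ → Ξ) (m : ℕ) : (sgLoop G γ x₁ ξ m).2 = m := by
  induction m with
  | zero => rfl
  | succ m ih => simp [sgLoop, ih]

theorem calls_le {run : Run Ω Ξ S} {γ : ℕ → ℝ} (hR : ∀ s ω, run.R s ω ∈ Finset.Icc 1 N) (ω : Ω) :
    run.calls G γ x₁ T ω ≤ S * (N + T) := by
  have h1 (s : Fin S) : (run.cand G γ x₁ s ω).2 ≤ N := by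
    simp only [Run.cand, rsg, sgLoop_calls]
    exact (Finset.mem_Icc.1 (hR s ω)).2
  have h2 (s : Fin S) : (run.est G γ x₁ T s ω).2 = T := by
    simp [Run.est, gradEst, gradSum_eq]
  have h3 := Finset.sum_le_sum fun s (_ : s ∈ Finset.univ) => h1 s
  simp only [Run.calls, h2]
  simp only [Finset.sum_const, Finset.card_univ, Fintype.card_fin, smul_eq_mul] at h3 ⊢
  rw [mul_add]
  omega

end Algorithm

/-! ### The two bad events and their union -/

section TwoPhase

variable {E Ξ Ω : Type*} [NormedAddCommGroup E] [InnerProductSpace ℝ E] [CompleteSpace E]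
  [MeasurableSpace E] [BorelSpace E] [SecondCountableTopology E] [MeasurableSpace Ξ]
  [MeasurableSpace Ω] {μ : Measure Ω} [IsProbabilityMeasure μ] {f : E → ℝ} {G : E → Ξ → E}
  {L σ : ℝ} {x₁ : E} {S N T : ℕ} {run : Run Ω Ξ S}

/-- With probability at least `1 - 2^{-S}` one of the candidates has a small gradient. -/
theorem measureReal_forall_cand_ge_le (hL : 0 < L) (hσ : 0 < σ) {Dt : ℝ} (hDt : 0 < Dt)
    (hN : 1 ≤ N) (hf : Differentiable ℝ f) (hbdd : BddBelow (Set.range f))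
    (hG : Measurable (fun p : E × Ξ => G p.1 p.2))
    (hlip : ∀ x y, ‖gradient f y - gradient f x‖ ≤ L * ‖y - x‖)
    (hrun : run.IsExecution μ G L (stepsize L σ Dt N) x₁ N T)
    (hA : run.OracleAssumptions μ f G σ (stepsize L σ Dt N) x₁ N T) :
    μ.real (⋂ s, {ω | 2 * L * BN f L σ Dt x₁ N ≤
        ‖gradient f (run.cand G (stepsize L σ Dt N) x₁ s ω).1‖ ^ 2}) ≤ 1 / 2 ^ S := by
  have hgrad := continuous_gradient_of_lipschitz hL hlip
  have hB : 0 < L * BN f L σ Dt x₁ N := mul_pos hL (BN_pos hL hσ hDt hN)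
  have hhalf (s : Fin S) : μ.real {ω | 2 * L * BN f L σ Dt x₁ N ≤
      ‖gradient f (run.cand G (stepsize L σ Dt N) x₁ s ω).1‖ ^ 2} ≤ 1 / 2 := by
    have h1 := integral_sq_gradient_stop_le hL hσ hDt hN hf hbdd hG hlip (hrun.measurable_ξ s)
      (hA.opt_A1 s) (hrun.measurable_R s) (hrun.R_mem s) (hrun.R_law s) (hrun.R_indep s)
    have h2 := (integral_sq_gradient_stop hL hG hlip (hrun.measurable_ξ s)
      (hA.opt_A1 s) (hrun.measurable_R s) (hrun.R_mem s) (hrun.R_indep s)).1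
    have h3 := (mul_meas_ge_le_integral_of_nonneg (μ := μ)
      (Filter.Eventually.of_forall fun ω => sq_nonneg _) h2 (2 * L * BN f L σ Dt x₁ N)).trans h1
    refine le_of_mul_le_mul_left (h3.trans (le_of_eq ?_)) (a := 2 * L * BN f L σ Dt x₁ N)
      (by linarith)
    ring
  -- Each failure event is determined by the stopping index and the inputs of its own run.
  have hind := hrun.runs_indep.meas_iInter (s := fun s =>
    {ω | 2 * L * BN f L σ Dt x₁ N ≤
      ‖gradient f (run.cand G (stepsize L σ Dt N) x₁ s ω).1‖ ^ 2}) fun s => by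
    have hpair := comap_measurable (m := inferInstance)
      (fun ω => (run.R s ω, fun k => run.ξ s k ω))
    have hc := measurable_searchPoint_stop hG (stepsize L σ Dt N) x₁
      (m := MeasurableSpace.comap (fun ω => (run.R s ω, fun k => run.ξ s k ω)) inferInstance)
      (ξ := run.ξ s) (R := run.R s) (N := N) (measurable_fst.comp hpair)
      (fun ω => (Finset.mem_Icc.1 (hrun.R_mem s ω)).2)
      (fun j _ => (measurable_pi_apply j).comp (measurable_snd.comp hpair))
    have hq : Measurable fun x : E => ‖gradient f x‖ ^ 2 := hgrad.measurable.norm.pow_const 2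
    exact (hq.comp hc) measurableSet_Ici
  rw [measureReal_def, hind, ENNReal.toReal_prod]
  calc _ ≤ ∏ _s : Fin S, (1 / 2 : ℝ) :=
        Finset.prod_le_prod (fun _ _ => ENNReal.toReal_nonneg) fun s _ => hhalf s
    _ = 1 / 2 ^ S := by simp

/-- The estimate of the gradient at a candidate is accurate with high probability. -/
theorem measureReal_est_error_ge_le (hL : 0 < L) (hσ : 0 < σ) {γ : ℕ → ℝ} (hT : 1 ≤ T)
    (hG : Measurable (fun p : E × Ξ => G p.1 p.2))
    (hlip : ∀ x y, ‖gradient f y - gradient f x‖ ≤ L * ‖y - x‖)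
    (hrun : run.IsExecution μ G L γ x₁ N T) (hA : run.OracleAssumptions μ f G σ γ x₁ N T)
    {lam : ℝ} (hlam : 0 < lam) (s : Fin S) :
    μ.real {ω | 9 / 4 * (1 + lam) ^ 2 * (σ ^ 2 / T) ≤
        ‖(run.est G γ x₁ T s ω).1 - gradient f (run.cand G γ x₁ s ω).1‖ ^ 2}
      ≤ Real.exp (-lam ^ 2 / 3) := by
  have hgrad := continuous_gradient_of_lipschitz hL hlip
  have hT0 : (0 : ℝ) < T := by exact_mod_cast hT
  have hsT : 0 < √(T : ℝ) := Real.sqrt_pos.2 hT0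
  -- The summands are indexed from 0 and the calls from 1, so `F k` is the past of call `k + 1`. It
  -- contains the first phase, which fixes the candidate.
  set F : ℕ → MeasurableSpace Ω := fun k => run.sigmaOpt N ⊔ sigmaBefore (run.ζ s) (k + 1)
  have hopt : run.sigmaOpt N ≤ ‹MeasurableSpace Ω› :=
    iSup_le fun s => sup_le (hrun.measurable_R s).comap_le
      (sigmaBefore_le (hrun.measurable_ξ s) _)
  have hF (k : ℕ) : F k ≤ ‹MeasurableSpace Ω› :=
    sup_le hopt (sigmaBefore_le (hrun.measurable_ζ s) _)
  have hc : Measurable[run.sigmaOpt N] fun ω => (run.cand G γ x₁ s ω).1 := by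
    have hle := le_iSup (fun s => MeasurableSpace.comap (run.R s) inferInstance ⊔
      sigmaBefore (run.ξ s) (N + 1)) s
    refine measurable_searchPoint_stop hG γ x₁
      ((comap_measurable (run.R s)).mono (le_sup_left.trans hle) le_rfl)
      (fun ω => (Finset.mem_Icc.1 (hrun.R_mem s ω)).2)
      (fun j hj => (measurable_sigmaBefore ?_).mono (le_sup_right.trans hle) le_rfl)
    simp only [Finset.mem_Icc, Finset.mem_Ico] at hj ⊢
    omega
  have hcF (k : ℕ) : Measurable[F k] fun ω => (run.cand G γ x₁ s ω).1 :=
    hc.mono le_sup_left le_rfl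
  have hc0 := hc.mono hopt le_rfl
  have hmem (k : ℕ) (hk : k < T) : k + 1 ∈ Finset.Icc 1 T := by
    simp only [Finset.mem_Icc]; omega
  have h := measureReal_norm_sum_ge_le (μ := μ) (F := F)
    (v := fun k ω => G (run.cand G γ x₁ s ω).1 (run.ζ s (k + 1) ω)
      - gradient f (run.cand G γ x₁ s ω).1) hT (fun k _ => hF k)
    (fun k _ => (Finset.measurable_fun_sum _ fun j hj => by
      have hζ : Measurable[F k] (run.ζ s (j + 1)) :=
        (measurable_sigmaBefore (by
          simp only [Finset.mem_range, Finset.mem_Ico] at hj ⊢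
          omega)).mono le_sup_right le_rfl
      exact (hG.comp ((hcF k).prodMk hζ)).sub (hgrad.measurable.comp (hcF k))).stronglyMeasurable)
    (fun k hk => (hA.post_A1 s (k + 1) (hmem k hk)).integrable_error hG hgrad hc0
      (hrun.measurable_ζ s _))
    (fun k hk => (hA.post_A1 s (k + 1) (hmem k hk)).condExp_error (hF k) hG hgrad (hcF k)
      (hrun.measurable_ζ s _)) hσ
    (fun k hk => (hA.post_A2 s (k + 1) (hmem k hk)).1)
    (fun k hk => (hA.post_A2 s (k + 1) (hmem k hk)).2) hlam
  refine (measureReal_mono fun ω hω => ?_).trans h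
  simp only [Set.mem_ofPred_eq] at hω ⊢
  rw [Run.est, norm_gradEst_sub hT, div_pow] at hω
  refine (pow_le_pow_iff_left₀ (by positivity) (norm_nonneg _) two_ne_zero).1 ?_
  rw [le_div_iff₀ (by positivity)] at hω
  refine le_trans (le_of_eq ?_) hω
  rw [mul_pow, Real.sq_sqrt hT0.le]
  field_simp
  ring

/-- The large deviation bound for the output of the two-phase method. -/
theorem measureReal_output_ge_le (hL : 0 < L) (hσ : 0 < σ) {Dt : ℝ} (hDt : 0 < Dt)
    (hN : 1 ≤ N) (hT : 1 ≤ T) (hf : Differentiable ℝ f) (hbdd : BddBelow (Set.range f))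
    (hG : Measurable (fun p : E × Ξ => G p.1 p.2))
    (hlip : ∀ x y, ‖gradient f y - gradient f x‖ ≤ L * ‖y - x‖)
    (hrun : run.IsExecution μ G L (stepsize L σ Dt N) x₁ N T)
    (hA : run.OracleAssumptions μ f G σ (stepsize L σ Dt N) x₁ N T) {lam : ℝ} (hlam : 0 < lam) :
    μ.real {ω | 4 * (2 * L * BN f L σ Dt x₁ N + 3 * (1 + lam) ^ 2 * (σ ^ 2 / T)) ≤
          ‖gradient f (run.output G (stepsize L σ Dt N) x₁ ω)‖ ^ 2}
        ≤ ((S : ℝ) + 1) * Real.exp (-lam ^ 2 / 3) + 1 / 2 ^ S := by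
  set γ := stepsize L σ Dt N
  set P : Set Ω := ⋂ s, {ω | 2 * L * BN f L σ Dt x₁ N ≤
        ‖gradient f (run.cand G γ x₁ s ω).1‖ ^ 2} with hP
  set Q : Fin S → Set Ω := fun s => {ω | 9 / 4 * (1 + lam) ^ 2 * (σ ^ 2 / T) ≤
        ‖(run.est G γ x₁ T s ω).1 - gradient f (run.cand G γ x₁ s ω).1‖ ^ 2} with hQ
  -- The selected index is random and depends on the estimates; asking for accuracy at all
  -- candidates at once covers it.
  have hsub : {ω | 4 * (2 * L * BN f L σ Dt x₁ N + 3 * (1 + lam) ^ 2 * (σ ^ 2 / T)) ≤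
          ‖gradient f (run.output G γ x₁ ω)‖ ^ 2} ⊆ (⋃ s, Q s) ∪ P := by
    intro ω hω
    by_contra hn
    simp only [hP, hQ, Set.mem_union, Set.mem_iUnion, Set.mem_iInter, Set.mem_ofPred_eq, not_or,
      not_exists, not_forall, not_le] at hn hω
    have h := sq_norm_lt_of_argmin (hrun.pick_min ω) hn.2 hn.1
    have e : run.output G γ x₁ ω = (run.cand G γ x₁ (run.pick ω) ω).1 := rfl
    rw [e] at hω
    linarith
  have h1 : μ.real (⋃ s, Q s) ≤ S * Real.exp (-lam ^ 2 / 3) := by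
    refine (measureReal_iUnion_fintype_le _).trans ?_
    refine (Finset.sum_le_sum fun s _ =>
      measureReal_est_error_ge_le hL hσ hT hG hlip hrun hA hlam s).trans (le_of_eq ?_)
    simp
  have h2 := measureReal_forall_cand_ge_le hL hσ hDt hN hf hbdd hG hlip hrun hA
  have h3 := (measureReal_mono (μ := μ) hsub).trans (measureReal_union_le _ _)
  have := Real.exp_pos (-lam ^ 2 / 3)
  linarith

end TwoPhase

/-! ### The parameter choices of part (b) -/

section Complexity

variable {E : Type*} {f : E → ℝ} {L σ Dt ε Λ : ℝ} {x₁ : E}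

theorem inv_two_pow_Sparam_le (hΛ : 0 < Λ) : 1 / 2 ^ Sparam Λ ≤ Λ / 2 := by
  have h := Nat.le_ceil (Real.logb 2 (2 / Λ))
  rw [Real.logb_le_iff_le_rpow (by norm_num) (by positivity), Real.rpow_natCast] at h
  rw [div_le_div_iff₀ (by positivity) (by norm_num)]
  rw [div_le_iff₀ hΛ] at h
  rw [Sparam]
  linarith

theorem one_le_Nparam (hL : 0 < L) (hσ : 0 < σ) (hDt : 0 < Dt) (hε : 0 < ε) :
    1 ≤ Nparam f L σ Dt x₁ ε := by
  -- `D_f` may vanish, so positivity comes from the second entry of the maximum.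
  refine Nat.one_le_iff_ne_zero.2 (Nat.ceil_pos.2 (lt_max_of_lt_right ?_)).ne'
  positivity

/-- Each entry of the maximum makes one summand of `16 L B_N` at most `ε / 2`. The factor 16 is
twice the 8 of the deviation bound, so this error takes half of `ε`. -/
theorem BN_Nparam_le (hL : 0 < L) (hσ : 0 < σ) (hDt : 0 < Dt) (hε : 0 < ε) :
    16 * L * BN f L σ Dt x₁ (Nparam f L σ Dt x₁ ε) ≤ ε := by
  have hN0 : (0 : ℝ) < (Nparam f L σ Dt x₁ ε : ℝ) :=
    Nat.cast_pos.2 (Nat.one_le_iff_ne_zero.1 (one_le_Nparam hL hσ hDt hε)).bot_lt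
  have hN := Nat.le_ceil (max (32 * L ^ 2 * Df f L x₁ ^ 2 / ε)
    ((32 * L * (Dt + Df f L x₁ ^ 2 / Dt) * (σ / ε)) ^ 2))
  change _ ≤ (Nparam f L σ Dt x₁ ε : ℝ) at hN
  have h1 := (le_max_left _ _).trans hN
  have h2 := (le_max_right _ _).trans hN
  rw [BN]
  generalize (Nparam f L σ Dt x₁ ε : ℝ) = n at *
  have hq : 0 < √n := Real.sqrt_pos.2 hN0
  have h2' := Real.le_sqrt_of_sq_le h2
  have e1 : 16 * L * (L * Df f L x₁ ^ 2 / n) ≤ ε / 2 := by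
    rw [div_le_iff₀ hε] at h1
    have : 16 * L * (L * Df f L x₁ ^ 2 / n) = 16 * L ^ 2 * Df f L x₁ ^ 2 / n := by ring
    rw [this, div_le_iff₀ hN0]
    linarith
  have e2 : 16 * L * ((Dt + Df f L x₁ ^ 2 / Dt) * (σ / √n)) ≤ ε / 2 := by
    have h3 : 32 * L * (Dt + Df f L x₁ ^ 2 / Dt) * (σ / ε)
        = 32 * L * (Dt + Df f L x₁ ^ 2 / Dt) * σ / ε := by ring
    rw [h3, div_le_iff₀ hε] at h2'
    have : 16 * L * ((Dt + Df f L x₁ ^ 2 / Dt) * (σ / √n))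
        = 16 * L * (Dt + Df f L x₁ ^ 2 / Dt) * σ / √n := by ring
    rw [this, div_le_iff₀ hq]
    linarith
  linarith

theorem one_le_Tparam (hσ : 0 < σ) (hε : 0 < ε) : 1 ≤ Tparam σ ε Λ := by
  refine Nat.one_le_iff_ne_zero.2 (Nat.ceil_pos.2 ?_).ne'
  positivity

/-- Twice the estimation term `12 (1 + λ)² σ² / T` of the deviation bound, which thus takes the
other half of `ε`. -/
theorem Tparam_bound (hσ : 0 < σ) (hε : 0 < ε) :
    24 * (1 + √(3 * Real.log (2 * ((Sparam Λ : ℝ) + 1) / Λ))) ^ 2 * (σ ^ 2 / Tparam σ ε Λ) ≤ ε := by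
  have hT0 : (0 : ℝ) < Tparam σ ε Λ := by exact_mod_cast one_le_Tparam hσ hε
  have h := Nat.le_ceil (24 * σ ^ 2 / ε *
    (1 + √(3 * Real.log (2 * ((Sparam Λ : ℝ) + 1) / Λ))) ^ 2)
  change _ ≤ (Tparam σ ε Λ : ℝ) at h
  generalize (1 + √(3 * Real.log (2 * ((Sparam Λ : ℝ) + 1) / Λ))) ^ 2 = w at *
  rw [div_mul_eq_mul_div, div_le_iff₀ hε] at h
  rw [← mul_div_assoc, div_le_iff₀ hT0]
  linarith

end Complexity

end TwoRSG

/-! ### The large deviation and complexity statements -/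

theorem mainTheorem4 {n : ℕ} {Ξ Ω : Type*} [MeasurableSpace Ξ] [MeasurableSpace Ω]
    (μ : Measure Ω) [IsProbabilityMeasure μ]
    (f : EuclideanSpace ℝ (Fin n) → ℝ) (L σ Dt : ℝ) (x₁ : EuclideanSpace ℝ (Fin n))
    (G : EuclideanSpace ℝ (Fin n) → Ξ → EuclideanSpace ℝ (Fin n))
    (hL : 0 < L) (hσ : 0 < σ) (hDt : 0 < Dt)
    (hf : Differentiable ℝ f) (hbdd : BddBelow (Set.range f))
    (hlip : ∀ x y, ‖gradient f y - gradient f x‖ ≤ L * ‖y - x‖)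
    (hG : Measurable (fun p : EuclideanSpace ℝ (Fin n) × Ξ => G p.1 p.2)) :
    (∀ (S N T : ℕ), 1 ≤ S → 1 ≤ N → 1 ≤ T → ∀ run : TwoRSG.Run Ω Ξ S,
      run.IsExecution μ G L (TwoRSG.stepsize L σ Dt N) x₁ N T →
      run.OracleAssumptions μ f G σ (TwoRSG.stepsize L σ Dt N) x₁ N T →
      ∀ lam : ℝ, 0 < lam →
        μ.real {ω | 4 * (2 * L * TwoRSG.BN f L σ Dt x₁ N + 3 * (1 + lam) ^ 2 * (σ ^ 2 / T)) ≤
          ‖gradient f (run.output G (TwoRSG.stepsize L σ Dt N) x₁ ω)‖ ^ 2}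
        ≤ ((S : ℝ) + 1) * Real.exp (-lam ^ 2 / 3) + 1 / 2 ^ S) ∧
    (∀ (ε Λ : ℝ), 0 < ε → 0 < Λ → Λ < 1 → ∀ (S N T : ℕ),
      S = TwoRSG.Sparam Λ → N = TwoRSG.Nparam f L σ Dt x₁ ε → T = TwoRSG.Tparam σ ε Λ →
      ∀ run : TwoRSG.Run Ω Ξ S,
      run.IsExecution μ G L (TwoRSG.stepsize L σ Dt N) x₁ N T →
      run.OracleAssumptions μ f G σ (TwoRSG.stepsize L σ Dt N) x₁ N T →
      (∀ ω, run.calls G (TwoRSG.stepsize L σ Dt N) x₁ T ω ≤ S * (N + T)) ∧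
      1 - Λ ≤
        μ.real {ω | ‖gradient f (run.output G (TwoRSG.stepsize L σ Dt N) x₁ ω)‖ ^ 2 ≤ ε}) := by
  refine ⟨fun S N T _ hN hT run hrun hA lam hlam =>
    TwoRSG.measureReal_output_ge_le hL hσ hDt hN hT hf hbdd hG hlip hrun hA hlam, ?_⟩
  intro ε Λ hε hΛ hΛ1 S N T hS hN hT run hrun hA
  refine ⟨TwoRSG.calls_le hrun.R_mem, ?_⟩
  have hN1 : 1 ≤ N := hN ▸ TwoRSG.one_le_Nparam hL hσ hDt hε
  have hT1 : 1 ≤ T := hT ▸ TwoRSG.one_le_Tparam hσ hε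
  have hBN := TwoRSG.BN_Nparam_le (f := f) (x₁ := x₁) hL hσ hDt hε
  have hTb := TwoRSG.Tparam_bound (Λ := Λ) hσ hε
  have hSb := TwoRSG.inv_two_pow_Sparam_le hΛ
  rw [← hN] at hBN
  rw [← hT, ← hS] at hTb
  rw [← hS] at hSb
  have hS0 : (0 : ℝ) ≤ S := Nat.cast_nonneg S
  have harg : 1 < 2 * ((S : ℝ) + 1) / Λ := by
    rw [lt_div_iff₀ hΛ]; linarith
  have hlog := Real.log_pos harg
  -- Chosen so that `(S + 1) exp (-lam² / 3) = Λ / 2`; the remaining `Λ / 2` bounds `2^{-S}`.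
  set lam : ℝ := √(3 * Real.log (2 * ((S : ℝ) + 1) / Λ)) with hlam
  have hlam0 : 0 < lam := Real.sqrt_pos.2 (by positivity)
  have hexp : Real.exp (-lam ^ 2 / 3) = Λ / (2 * ((S : ℝ) + 1)) := by
    rw [hlam, Real.sq_sqrt (by positivity), neg_div, mul_div_cancel_left₀ _ (by norm_num),
      Real.exp_neg, Real.exp_log (by positivity), inv_div]
  have h := TwoRSG.measureReal_output_ge_le hL hσ hDt hN1 hT1 hf hbdd hG hlip hrun hA hlam0
  have hhalf : ((S : ℝ) + 1) * (Λ / (2 * ((S : ℝ) + 1))) = Λ / 2 := by field_simp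
  rw [hexp, hhalf] at h
  -- Subadditivity over a cover of the whole space gives the lower bound without measurability of
  -- the output.
  have hcover : (Set.univ : Set Ω) ⊆
      {ω | ‖gradient f (run.output G (TwoRSG.stepsize L σ Dt N) x₁ ω)‖ ^ 2 ≤ ε} ∪
      {ω | 4 * (2 * L * TwoRSG.BN f L σ Dt x₁ N + 3 * (1 + lam) ^ 2 * (σ ^ 2 / T)) ≤
          ‖gradient f (run.output G (TwoRSG.stepsize L σ Dt N) x₁ ω)‖ ^ 2} := by
    intro ω _
    rcases le_total (‖gradient f (run.output G (TwoRSG.stepsize L σ Dt N) x₁ ω)‖ ^ 2) ε with h | h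
    · exact Or.inl h
    · exact Or.inr (le_trans (by linarith) h)
  have h1 := (measureReal_mono (μ := μ) hcover).trans (measureReal_union_le _ _)
  rw [probReal_univ] at h1
  linarith
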